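/- Graphs are finite, simple and undirected. For a graph $G$ and an integer $k\ge 0$ let $G^{k}$ be the graph obtained from $G$ by iteratively deleting vertices of degree at most $k$ until the remaining graph has minimum degree at least $k+1$ or is empty (it does not depend on the order of deletion). For integers $m\ge n\ge 1$ let $r=r_{m,n}$ and $t=t_{m,n}$ be the unique integers with $m-n=\binom{r-1}{2}+t-2$ and $2\le t\le r$. Let $K_r^t$ be the graph obtained from the complete graph $K_r$ by joining a new vertex to $t$ of its vertices, and let $\mathbb{B}(r,3)$ be the set of graphs obtained from $K_r$ and a triangle by adding a path of length $\ell\ge 0$ between a vertex of $K_r$ and a vertex of the triangle (for $\ell=0$ the two vertices are identified). **Theorem.** Let $m,n,s$ be integers with $n\ge1$, $s\ge 3$ and $\binom s2-s\le m-n\le\binom n2-n$, and let $G$ be a connected graph with $n$ vertices and $m$ edges. (i) If $t_{m,n}\le s-2$, then $G$ has the maximum number of $s$-cliques among all connected graphs with $n$ vertices and $m$ edges if and only if $G^{s-2}\cong K_{r_{m,n}}$. (ii) If $t_{m,n}\ge s-1$, then $G$ has the maximum number of $s$-cliques among all connected graphs with $n$ vertices and $m$ edges if and only if $G^{s-2}\cong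 K_{r_{m,n}}^{t_{m,n}}$, or $s=3$, $t_{m,n}=2$, $r_{m,n}\ge 3$ and $G^{s-2}$ is isomorphic to a graph in $\mathbb{B}(r_{m,n},3)$. -/

import Mathlib

namespace CliqueExtremal

/-- `G` is a connected graph of order `n` and size `m`. -/
def IsConnGraph {V : Type*} (m n : ℕ) (G : SimpleGraph V) : Prop :=
  G.Connected ∧ Nat.card V = n ∧ G.edgeSet.ncard = m

/-- The number of `s`-cliques of `G`. -/
noncomputable def cliqueCount {V : Type*} (s : ℕ) (G : SimpleGraph V) : ℕ :=
  {S : Finset V | G.IsNClique s S}.ncard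

/-- `G` has the maximum number of `s`-cliques over all connected graphs of order `n` and size `m`
(every graph of order `n` being isomorphic to one on `Fin n`). -/
def IsExtremal {V : Type*} (m n s : ℕ) (G : SimpleGraph V) : Prop :=
  IsConnGraph m n G ∧
    ∀ H : SimpleGraph (Fin n), IsConnGraph m n H → cliqueCount s H ≤ cliqueCount s G

/-- The degree of `v` in the subgraph of `G` induced by `S` (for `v ∈ S`). -/
noncomputable def degIn {V : Type*} (G : SimpleGraph V) (S : Set V) (v : V) : ℕ :=
  (G.neighborSet v ∩ S).ncard

/-- `DeletesTo G k S`: the set `S` is what remains of the vertices of `G` after some sequence of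
deletions of single vertices, each of degree at most `k` in the graph present at that moment. -/
inductive DeletesTo {V : Type*} (G : SimpleGraph V) (k : ℕ) : Set V → Prop
  | start : DeletesTo G k Set.univ
  | delete {S : Set V} {v : V} :
      DeletesTo G k S → v ∈ S → degIn G S v ≤ k → DeletesTo G k (S \ {v})

/-- A final outcome of the deletion process: the remaining graph has minimum degree at least
`k + 1` or is empty. -/
def IsResidue {V : Type*} (G : SimpleGraph V) (k : ℕ) (S : Set V) : Prop :=
  DeletesTo G k S ∧ ∀ v ∈ S, k + 1 ≤ degIn G S v

/-- The deletion process has a final outcome, which does not depend on the order of deletion. -/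
theorem existsUnique_isResidue {V : Type*} [Finite V] (G : SimpleGraph V) (k : ℕ) :
    ∃! S : Set V, IsResidue G k S := by
  have hex : ∀ (a : ℕ) (S : Set V), S.ncard = a → DeletesTo G k S →
      ∃ T, IsResidue G k T := by
    intro a
    induction a with
    | zero =>
      intro S hS hd
      refine ⟨S, hd, fun v hv => ?_⟩
      rw [Set.ncard_eq_zero (Set.toFinite S)] at hS
      simp [hS] at hv
    | succ a ih =>
      intro S hS hd
      by_cases h : ∀ v ∈ S, k + 1 ≤ degIn G S v
      · exact ⟨S, hd, h⟩
      · push Not at h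
        obtain ⟨v, hv, hlt⟩ := h
        refine ih (S \ {v}) ?_ (DeletesTo.delete hd hv (by omega))
        rw [Set.ncard_sdiff_singleton_of_mem hv, hS]
        rfl
  have hsub : ∀ (T : Set V), (∀ v ∈ T, k + 1 ≤ degIn G T v) →
      ∀ S : Set V, DeletesTo G k S → T ⊆ S := by
    intro T hT S hS
    induction hS with
    | start => exact Set.subset_univ T
    | @delete S v _ _ hdeg ih =>
      intro x hx
      refine ⟨ih hx, ?_⟩
      rintro rfl
      have h1 := hT x hx
      have h2 : degIn G T x ≤ degIn G S x :=
        Set.ncard_le_ncard (Set.inter_subset_inter_right _ ih) (Set.toFinite _)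
      omega
  obtain ⟨T, hT⟩ := hex _ Set.univ rfl DeletesTo.start
  refine ⟨T, hT, fun S hS => ?_⟩
  exact Set.Subset.antisymm (hsub S hS.2 T hT.1) (hsub T hT.2 S hS.1)

/-- The vertex set of `G ^ k`. -/
noncomputable def residue {V : Type*} [Finite V] (G : SimpleGraph V) (k : ℕ) : Set V :=
  (existsUnique_isResidue G k).choose

theorem isResidue_residue {V : Type*} [Finite V] (G : SimpleGraph V) (k : ℕ) :
    IsResidue G k (residue G k) :=
  (existsUnique_isResidue G k).choose_spec.1

/-- The graph `G ^ k`, obtained from `G` by iteratively deleting vertices of degree at most `k`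
until the remaining graph has minimum degree at least `k + 1` or is empty. -/
noncomputable def residueGraph {V : Type*} [Finite V] (G : SimpleGraph V) (k : ℕ) :
    SimpleGraph (residue G k) :=
  G.induce (residue G k)

/-- `r` and `t` are the numbers `r_{m,n}` and `t_{m,n}`. -/
def IsParams (m n r t : ℕ) : Prop :=
  1 ≤ r ∧ 1 ≤ t ∧
    (m : ℤ) - n = ((r - 1).choose 2 : ℤ) + t - 2 ∧
    (n ≤ m → 2 ≤ t ∧ t ≤ r) ∧
    (m + 1 = n → r = 1 ∧ t = 1)

/-- The numbers `r_{m,n}` and `t_{m,n}` exist and are unique. -/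
theorem existsUnique_isParams (m n : ℕ) (h : n ≤ m + 1) :
    ∃! p : ℕ × ℕ, IsParams m n p.1 p.2 := by
  rcases Nat.lt_or_ge m n with hmn | hmn
  · have hn : n = m + 1 := by omega
    subst hn
    refine ⟨(1, 1), ⟨le_rfl, le_rfl, by simp, by omega, by simp⟩, ?_⟩
    rintro ⟨r, t⟩ ⟨-, -, -, -, h5⟩
    obtain ⟨h6, h7⟩ := h5 rfl
    exact Prod.ext h6 h7
  · obtain ⟨d, rfl⟩ := Nat.exists_eq_add_of_le hmn
    have hstep : ∀ r : ℕ, (r + 1).choose 2 = r.choose 2 + r := by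
      intro r
      rw [Nat.choose_succ_succ' r 1, Nat.choose_one_right, Nat.add_comm]
    have hmono : ∀ a b : ℕ, a ≤ b → a.choose 2 ≤ b.choose 2 := fun a b hab =>
      Nat.choose_le_choose 2 hab
    have hex : ∃ q : ℕ, d < (q + 1).choose 2 := by
      refine ⟨d + 1, ?_⟩
      have h1 := hstep (d + 1)
      omega
    classical
    have hq := Nat.find_spec hex
    set q := Nat.find hex with hqdef
    have hq1 : 1 ≤ q := by
      rcases Nat.eq_zero_or_pos q with h0 | h0
      · rw [h0] at hq
        simp at hq
      · exact h0
    have hlow : q.choose 2 ≤ d := by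
      have h1 := Nat.find_min hex (m := q - 1) (by omega)
      rw [Nat.sub_add_cancel hq1] at h1
      omega
    have hs := hstep q
    refine ⟨(q + 1, d - q.choose 2 + 2), ⟨by simp, by simp, ?_, ?_, by omega⟩, ?_⟩
    · simp only [Nat.add_sub_cancel]
      push_cast [hlow]
      ring
    · intro _
      simp only
      omega
    · rintro ⟨r, t⟩ ⟨h1, -, h3, h4, -⟩
      simp only at h1 h3 h4
      obtain ⟨h5, h6⟩ := h4 (by omega)
      obtain ⟨a, rfl⟩ := Nat.exists_eq_add_of_le' h1
      simp only [Nat.add_sub_cancel] at h3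
      have h7 : d + 2 = a.choose 2 + t := by
        push_cast at h3
        omega
      have h8 := hstep a
      have haq : a = q := by
        rcases lt_trichotomy a q with h9 | h9 | h9
        · have := hmono (a + 1) q h9
          omega
        · exact h9
        · have := hmono (q + 1) a h9
          omega
      subst haq
      refine Prod.ext rfl ?_
      simp only
      omega

/-- The graph `K_r^t`: a copy of `K_r` on `0, …, r - 1`, and a new vertex `r` joined to the
`t` vertices `0, …, t - 1` of it (`t ≤ r`). -/
def cliquePlus (r t : ℕ) : SimpleGraph (Fin (r + 1)) :=
  SimpleGraph.fromRel fun i j =>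
    (i.val < r ∧ j.val < r) ∨ (i.val < t ∧ j.val = r)

/-- A copy of `K_p` and a copy of the cycle `C_q` joined by a path of length `l` between a vertex
of the one and a vertex of the other (the two are identified if `l = 0`), for `p ≥ 1`, `q ≥ 3`.
`K_p` is on `0, …, p - 1`, the path is `p - 1, …, p - 1 + l`, and the cycle is
`p - 1 + l, …, p - 1 + l + (q - 1)`, closed by the edge between its first and its last vertex. -/
def cliquePathCycle (p q l : ℕ) : SimpleGraph (Fin (p + l + q - 1)) :=
  SimpleGraph.fromRel fun i j =>
    (i.val < p ∧ j.val < p) ∨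
    (p ≤ i.val + 1 ∧ j.val = i.val + 1) ∨
    (i.val + 1 = p + l ∧ j.val + 2 = p + l + q)

/-- `G` belongs, up to isomorphism, to the family of graphs obtained from `K_p` and `C_q` by adding
a path of some length `l ≥ 0` between a vertex of `K_p` and a vertex of `C_q`. -/
def IsCliquePathCycle {V : Type*} (p q : ℕ) (G : SimpleGraph V) : Prop :=
  ∃ l : ℕ, Nonempty (G ≃g cliquePathCycle p q l)

end CliqueExtremal

set_option linter.unusedSectionVars false

namespace CliqueExtremal

/-! Put k = s − 1 and let b = m − n + 1 be the cyclomatic number. Writing b = C(q,2) + u with u < q,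
the bound for (k+1)-cliques is C(q+1,k+1) + C(u+1,k), the count in a K_{q+1} with one more vertex of
degree u + 1. For t < r this means q = r − 1 and u = t − 1; for t = r it means q = r and u = 0.

The bound, `card_cliquesIn_le_maxCliques`, goes by induction on the vertex set. At a cut vertex both
cyclomatic numbers and clique counts add up, and the bound is superadditive (`maxCliques_add_le`).
Without a cut vertex, delete a vertex of minimum degree l + 1: b drops by l, at most C(l+1,k)
cliques disappear, and the degree condition forces b ≥ C(l+1,2), which puts l in the range where
`maxCliques_add_choose_le` applies. Following the equality cases shows that a graph attaining a
positive bound contains a clique K on q + 1 vertices.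

Relative to K the graph has cyclomatic excess u. Growing it from K, a new vertex with l + 1 earlier
neighbours uses l of the excess and creates at most C(l+1,k) cliques. By convexity, when u + 1 ≥ k
equality forces the whole excess onto a single vertex, whose neighbours lie in K unless k = 2 and u
= 1, when one triangle may hang elsewhere (`exists_vertex_of_card_cliquesIn_eq`).

The core G^{s−2} has minimum degree at least k, so a core vertex outside a connected set Y costs k −
1 of excess beyond that of Y (`ConnOn.add_le_of_minDegree`). This leaves K alone, K with one vertex,
or K with a path to a triangle. Conversely each listed core already contains as many cliques as the
bound allows, and `exists_connGraph_cliqueCount_ge` shows that the bound is attained. -/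

/-! ### Convexity of binomial coefficients and the extremal function -/

/-- Convexity of x ↦ C(x,k): an increment j gains at least as much at the larger argument. By Pascal
each unit of increment reduces to monotonicity of the coefficients one index lower. -/
theorem choose_add_choose_le (k a b j : ℕ) (hab : a ≤ b) :
    (a + j).choose k + b.choose k ≤ a.choose k + (b + j).choose k := by
  rcases k with _ | k
  · simp
  induction j with
  | zero => simp
  | succ j ih =>
    have h1 := Nat.choose_succ_succ' (a + j) k
    have h2 := Nat.choose_succ_succ' (b + j) k
    have h3 : (a + j).choose k ≤ (b + j).choose k := Nat.choose_le_choose k (by omega)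
    rw [← add_assoc, ← add_assoc]
    omega

theorem choose_lt_choose_of_lt {k a b : ℕ} (hab : a < b) (hk : 1 ≤ k) (hkb : k ≤ b) :
    a.choose k < b.choose k := by
  obtain ⟨k, rfl⟩ := Nat.exists_eq_add_of_le' hk
  obtain ⟨b, rfl⟩ := Nat.exists_eq_add_of_le' (Nat.one_le_of_lt hab)
  have h1 := Nat.choose_succ_succ' b k
  have h2 : 0 < b.choose k := Nat.choose_pos (by omega)
  have h3 : a.choose (k + 1) ≤ b.choose (k + 1) := Nat.choose_le_choose _ (by omega)
  omega

theorem choose_add_choose_lt {k a b j : ℕ} (hab : a < b) (hj : 0 < j) (hk : 2 ≤ k)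
    (hkb : k ≤ b + j) :
    (a + j).choose k + b.choose k < a.choose k + (b + j).choose k := by
  obtain ⟨k, rfl⟩ := Nat.exists_eq_add_of_le' (show 1 ≤ k by omega)
  obtain ⟨j, rfl⟩ := Nat.exists_eq_add_of_le' (show 1 ≤ j from hj)
  have h0 := choose_add_choose_le (k + 1) a b j hab.le
  have h1 := Nat.choose_succ_succ' (a + j) k
  have h2 := Nat.choose_succ_succ' (b + j) k
  have h3 : (a + j).choose k < (b + j).choose k :=
    choose_lt_choose_of_lt (by omega) (by omega) (by omega)
  rw [← add_assoc, ← add_assoc]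
  omega

/-- Superadditivity of x ↦ C(x+1,k), which is convexity starting at 1, where C(1,k) = 0 because k ≥
2. It expresses that concentrating excess never loses cliques. -/
theorem choose_succ_add_le {k : ℕ} (hk : 2 ≤ k) (a b : ℕ) :
    (a + 1).choose k + (b + 1).choose k ≤ (a + b + 1).choose k := by
  have h := choose_add_choose_le k 1 (b + 1) a (by omega)
  rw [Nat.choose_eq_zero_of_lt (show 1 < k by omega), show 1 + a = a + 1 by omega,
    show b + 1 + a = a + b + 1 by omega] at h
  omega

theorem choose_succ_add_lt {k a b : ℕ} (hk : 2 ≤ k) (ha : 0 < a) (hb : 0 < b)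
    (hkab : k ≤ a + b + 1) :
    (a + 1).choose k + (b + 1).choose k < (a + b + 1).choose k := by
  have h := choose_add_choose_lt (k := k) (a := 1) (b := b + 1) (j := a) (by omega) ha hk
    (by omega)
  rw [Nat.choose_eq_zero_of_lt (show 1 < k by omega), show 1 + a = a + 1 by omega,
    show b + 1 + a = a + b + 1 by omega] at h
  omega

theorem succ_choose_two (q : ℕ) : (q + 1).choose 2 = q.choose 2 + q := by
  rw [Nat.choose_succ_succ' q 1, Nat.choose_one_right, Nat.add_comm]

theorem exists_lt_succ_choose_two (b : ℕ) : ∃ q : ℕ, b < (q + 1).choose 2 :=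
  ⟨b + 1, by have := succ_choose_two (b + 1); omega⟩

/-- The largest `q ≥ 1` with `q.choose 2 ≤ b`. -/
def triIndex (b : ℕ) : ℕ := Nat.find (exists_lt_succ_choose_two b)

theorem triIndex_eq {q u : ℕ} (h : u < q) : triIndex (q.choose 2 + u) = q := by
  refine (Nat.find_eq_iff _).2 ⟨?_, fun p hp => ?_⟩
  · rw [succ_choose_two]
    omega
  · have := Nat.choose_le_choose 2 (show p + 1 ≤ q by omega)
    omega

theorem exists_eq_choose_two_add (b : ℕ) : ∃ q u, u < q ∧ b = q.choose 2 + u := by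
  have h := Nat.find_spec (exists_lt_succ_choose_two b)
  have h' := fun p => Nat.find_min (exists_lt_succ_choose_two b) (m := p)
  set q := Nat.find (exists_lt_succ_choose_two b)
  have h0 : 0 < q := by
    rcases Nat.eq_zero_or_pos q with h0 | h0
    · rw [h0] at h
      simp at h
    · exact h0
  have h1 := h' (q - 1) (by omega)
  rw [Nat.sub_add_cancel h0] at h1
  rw [succ_choose_two] at h
  exact ⟨q, b - q.choose 2, by omega, by omega⟩

/-- The largest number of `(k + 1)`-cliques in a connected graph of cyclomatic number `b`. -/
def maxCliques (k b : ℕ) : ℕ :=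
  (triIndex b + 1).choose (k + 1) + (b - (triIndex b).choose 2 + 1).choose k

theorem maxCliques_of_lt (k : ℕ) {q u : ℕ} (h : u < q) :
    maxCliques k (q.choose 2 + u) = (q + 1).choose (k + 1) + (u + 1).choose k := by
  rw [maxCliques, triIndex_eq h, Nat.add_sub_cancel_left]

/-- By Pascal's rule the formula persists at u = q, where the index really jumps to q + 1. This
boundary case is the case t = r of the theorem. -/
theorem maxCliques_of_le {k q u : ℕ} (hk : 2 ≤ k) (h : u ≤ q) :
    maxCliques k (q.choose 2 + u) = (q + 1).choose (k + 1) + (u + 1).choose k := by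
  rcases h.lt_or_eq with h | rfl
  · exact maxCliques_of_lt k h
  · have := maxCliques_of_lt k (show 0 < u + 1 by omega)
    rw [succ_choose_two, add_zero] at this
    rw [this, zero_add, Nat.choose_eq_zero_of_lt (show 1 < k by omega),
      Nat.choose_succ_succ' (u + 1) k]
    omega

theorem maxCliques_zero {k : ℕ} (hk : 2 ≤ k) : maxCliques k 0 = 0 := by
  have h := maxCliques_of_lt k (show 0 < 1 by omega)
  rw [Nat.choose_eq_zero_of_lt (show 1 + 1 < k + 1 by omega),
    Nat.choose_eq_zero_of_lt (show 0 + 1 < k by omega)] at h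
  simpa using h

/-- The arithmetic of deleting one vertex of degree l + 1. Write a = C(p,2) + u. If u + l > p, the
pair (u+1, l+1) is spread to (u+l−p+1, p+1) and convexity applies; otherwise superadditivity does.
The two equality outcomes say where the large clique will be found: around the deleted vertex, or
already in the rest of the graph. -/
theorem maxCliques_add_choose_le {k a l : ℕ} (hk : 2 ≤ k) (hl : l ≤ triIndex a) :
    maxCliques k a + (l + 1).choose k ≤ maxCliques k (a + l) ∧
      (maxCliques k a + (l + 1).choose k = maxCliques k (a + l) → 0 < maxCliques k (a + l) →
        (l = triIndex a ∧ triIndex (a + l) = triIndex a + 1 ∧ k ≤ l + 1) ∨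
          (triIndex (a + l) = triIndex a ∧ 0 < maxCliques k a)) := by
  obtain ⟨p, u, hu, rfl⟩ := exists_eq_choose_two_add a
  rw [triIndex_eq hu] at hl ⊢
  rw [maxCliques_of_lt k hu]
  rcases Nat.lt_or_ge p (u + l) with h | h
  · have e : p.choose 2 + u + l = (p + 1).choose 2 + (u + l - p) := by
      rw [succ_choose_two]; omega
    rw [e, maxCliques_of_lt k (show u + l - p < p + 1 by omega),
      triIndex_eq (show u + l - p < p + 1 by omega), Nat.choose_succ_succ' (p + 1) k]
    have h1 := choose_add_choose_le k (u + l - p + 1) (u + 1) (p - u) (by omega)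
    have h2 := choose_add_choose_le k (u + l - p + 1) (l + 1) (p - l) (by omega)
    rw [show u + l - p + 1 + (p - l) = u + 1 by omega, show l + 1 + (p - l) = p + 1 by omega] at h2
    refine ⟨by omega, fun heq hpos => ?_⟩
    rcases hl.lt_or_eq with hl | rfl
    -- With l < p the spreading is strict, so equality could only come from all terms being zero,
    -- which positivity excludes.
    · rcases Nat.lt_or_ge (p + 1) k with h3 | h3
      · rw [Nat.choose_eq_zero_of_lt h3, Nat.choose_eq_zero_of_lt (show p + 1 < k + 1 by omega),
          Nat.choose_eq_zero_of_lt (show u + l - p + 1 < k by omega)] at hpos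
        omega
      · have h4 := choose_add_choose_lt (k := k) (a := u + l - p + 1) (b := l + 1) (j := p - l)
          (by omega) (by omega) hk (by omega)
        rw [show u + l - p + 1 + (p - l) = u + 1 by omega,
          show l + 1 + (p - l) = p + 1 by omega] at h4
        omega
    · refine Or.inl ⟨rfl, rfl, ?_⟩
      by_contra h3
      rw [Nat.choose_eq_zero_of_lt (show l + 1 < k by omega),
        Nat.choose_eq_zero_of_lt (show l + 1 < k + 1 by omega),
        Nat.choose_eq_zero_of_lt (show u + l - l + 1 < k by omega)] at hpos
      omega
  · rw [add_assoc (p.choose 2), maxCliques_of_le hk h]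
    have h1 := choose_succ_add_le hk u l
    refine ⟨by omega, fun heq hpos => ?_⟩
    rcases h.lt_or_eq with h2 | h2
    · refine Or.inr ⟨triIndex_eq h2, ?_⟩
      rcases Nat.lt_or_ge p k with h3 | h3
      · rw [Nat.choose_eq_zero_of_lt (show p + 1 < k + 1 by omega),
          Nat.choose_eq_zero_of_lt (show u + l + 1 < k by omega)] at hpos
        omega
      · have : 0 < (p + 1).choose (k + 1) := Nat.choose_pos (by omega)
        omega
    · rcases Nat.eq_zero_or_pos u with rfl | hu0
      · refine Or.inl ⟨by omega, ?_, ?_⟩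
        · rw [h2, ← add_zero (p.choose 2 + p), ← succ_choose_two, triIndex_eq (by omega)]
        · by_contra h3
          rw [Nat.choose_eq_zero_of_lt (show p + 1 < k + 1 by omega),
            Nat.choose_eq_zero_of_lt (show 0 + l + 1 < k by omega)] at hpos
          omega
      · exfalso
        rcases Nat.lt_or_ge (u + l + 1) k with h3 | h3
        · rw [Nat.choose_eq_zero_of_lt (show p + 1 < k + 1 by omega),
            Nat.choose_eq_zero_of_lt h3] at hpos
          omega
        · have := choose_succ_add_lt hk hu0 (show 0 < l by omega) h3
          omega

theorem triIndex_mono {a b : ℕ} (h : a ≤ b) : triIndex a ≤ triIndex b :=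
  Nat.find_mono fun _ hq => h.trans_lt hq

/-- Transfer b to the larger number a in pieces l, each worth C(l+1,k), using
`maxCliques_add_choose_le` each time. The pieces satisfy l < `triIndex b` ≤ `triIndex a`, and this
strictness excludes the first equality outcome there, so the index of a never grows. -/
theorem maxCliques_add_le {k : ℕ} (hk : 2 ≤ k) (b a : ℕ) (hab : b ≤ a) :
    maxCliques k a + maxCliques k b ≤ maxCliques k (a + b) ∧
      (maxCliques k a + maxCliques k b = maxCliques k (a + b) → 0 < maxCliques k (a + b) →
        triIndex (a + b) = triIndex a ∧ 0 < maxCliques k a) := by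
  induction b using Nat.strong_induction_on generalizing a with
  | _ b ih =>
    rcases Nat.eq_zero_or_pos b with rfl | hb
    · simp [maxCliques_zero hk]
    have key : ∃ c l, c + l = b ∧ 0 < l ∧ l < triIndex b ∧
        maxCliques k b = maxCliques k c + (l + 1).choose k := by
      obtain ⟨p, u, hu, rfl⟩ := exists_eq_choose_two_add b
      rw [triIndex_eq hu]
      -- If b is a triangular number C(p+1,2), the piece removed is p, leaving C(p,2); otherwise it
      -- is the remainder u.
      rcases Nat.eq_zero_or_pos u with rfl | hu0
      · obtain ⟨p, rfl⟩ := Nat.exists_eq_add_of_le' hu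
        have hp : 0 < p := by
          rcases Nat.eq_zero_or_pos p with rfl | h
          · simp at hb
          · exact h
        refine ⟨p.choose 2, p, by rw [succ_choose_two]; omega, hp, by omega, ?_⟩
        rw [succ_choose_two, add_zero, maxCliques_of_le hk le_rfl]
        have := maxCliques_of_le (q := p) hk (Nat.zero_le _)
        rw [Nat.choose_eq_zero_of_lt (show 0 + 1 < k by omega)] at this
        simpa using this.symm
      · refine ⟨p.choose 2, u, rfl, hu0, hu, ?_⟩
        have := maxCliques_of_le (q := p) hk (Nat.zero_le _)
        rw [Nat.choose_eq_zero_of_lt (show 0 + 1 < k by omega)] at this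
        rw [maxCliques_of_lt k hu]
        simp only [add_zero] at this
        omega
    obtain ⟨c, l, hcl, hl0, hl, hF⟩ := key
    have hla : l < triIndex a := hl.trans_le (triIndex_mono hab)
    obtain ⟨h1, h2⟩ := maxCliques_add_choose_le hk hla.le
    obtain ⟨h3, h4⟩ := ih c (by omega) (a + l) (by omega)
    rw [show a + l + c = a + b by omega] at h3 h4
    refine ⟨by omega, fun heq hpos => ?_⟩
    obtain ⟨h5, h6⟩ := h4 (by omega) hpos
    rcases h2 (by omega) h6 with h7 | h7
    · omega
    · exact ⟨h5.trans h7.1, h7.2⟩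

/-! ### Cliques, edges and connectivity inside a finite vertex set -/

section Local

variable {V : Type*} [DecidableEq V] (G : SimpleGraph V)

/-- The `j`-cliques of `G` inside `S`. -/
noncomputable def cliquesIn (j : ℕ) (S : Finset V) : Finset (Finset V) := by
  classical exact (S.powersetCard j).filter fun T => G.IsClique T

/-- The neighbours of `v` inside `S`. -/
noncomputable def nbrsIn (v : V) (S : Finset V) : Finset V := by
  classical exact S.filter (G.Adj v)

variable {G}

@[simp] theorem mem_cliquesIn {j : ℕ} {S T : Finset V} :
    T ∈ cliquesIn G j S ↔ (T ⊆ S ∧ T.card = j) ∧ G.IsClique T := by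
  simp [cliquesIn, Finset.mem_powersetCard]

@[simp] theorem mem_nbrsIn {v w : V} {S : Finset V} : w ∈ nbrsIn G v S ↔ w ∈ S ∧ G.Adj v w := by
  simp [nbrsIn]

theorem nbrsIn_subset (v : V) (S : Finset V) : nbrsIn G v S ⊆ S := fun _ h => (mem_nbrsIn.1 h).1

theorem nbrsIn_mono (v : V) {S T : Finset V} (h : S ⊆ T) : nbrsIn G v S ⊆ nbrsIn G v T :=
  fun _ hw => mem_nbrsIn.2 ⟨h (mem_nbrsIn.1 hw).1, (mem_nbrsIn.1 hw).2⟩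

theorem card_nbrsIn_mono (v : V) {S T : Finset V} (h : S ⊆ T) :
    (nbrsIn G v S).card ≤ (nbrsIn G v T).card := Finset.card_le_card (nbrsIn_mono v h)

theorem nbrsIn_insert_self (v : V) (S : Finset V) : nbrsIn G v (insert v S) = nbrsIn G v S := by
  ext w
  simp only [mem_nbrsIn, Finset.mem_insert]
  constructor
  · rintro ⟨rfl | h, h'⟩
    · exact absurd h' G.irrefl
    · exact ⟨h, h'⟩
  · rintro ⟨h, h'⟩
    exact ⟨Or.inr h, h'⟩

theorem cliquesIn_mono (j : ℕ) {S T : Finset V} (h : S ⊆ T) :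
    cliquesIn G j S ⊆ cliquesIn G j T := fun A hA => by
  rw [mem_cliquesIn] at hA ⊢
  exact ⟨⟨hA.1.1.trans h, hA.1.2⟩, hA.2⟩

theorem card_cliquesIn_mono (j : ℕ) {S T : Finset V} (h : S ⊆ T) :
    (cliquesIn G j S).card ≤ (cliquesIn G j T).card := Finset.card_le_card (cliquesIn_mono j h)

theorem card_cliquesIn_le (j : ℕ) (S : Finset V) : (cliquesIn G j S).card ≤ S.card.choose j := by
  rw [← Finset.card_powersetCard]
  exact Finset.card_le_card fun T hT =>
    Finset.mem_powersetCard.2 (mem_cliquesIn.1 hT).1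

theorem cliquesIn_of_isClique (j : ℕ) {S : Finset V} (h : G.IsClique S) :
    cliquesIn G j S = S.powersetCard j := by
  ext T
  rw [mem_cliquesIn, Finset.mem_powersetCard]
  exact ⟨fun h => h.1, fun h' => ⟨h', h.subset (Finset.coe_subset.2 h'.1)⟩⟩

theorem card_cliquesIn_of_isClique (j : ℕ) {S : Finset V} (h : G.IsClique S) :
    (cliquesIn G j S).card = S.card.choose j := by
  rw [cliquesIn_of_isClique j h, Finset.card_powersetCard]

/-- Every pair in `S` extends to a `j`-subset of `S`, and the count leaves no `j`-subset that fails
to be a clique. -/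
theorem isClique_of_card_cliquesIn {j : ℕ} {S : Finset V} (hj : 2 ≤ j) (hjS : j ≤ S.card)
    (h : (cliquesIn G j S).card = S.card.choose j) : G.IsClique S := by
  have heq : cliquesIn G j S = S.powersetCard j :=
    Finset.eq_of_subset_of_card_le
      (fun T hT => Finset.mem_powersetCard.2 (mem_cliquesIn.1 hT).1)
      (by rw [h, Finset.card_powersetCard])
  intro a ha b hb hab
  obtain ⟨T, hT1, hT2, hT3⟩ := Finset.exists_subsuperset_card_eq (s := {a, b}) (t := S) (n := j)
    (by
      intro x hx
      rcases Finset.mem_insert.1 hx with rfl | hx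
      · exact ha
      · rw [Finset.mem_singleton.1 hx]; exact hb)
    (by rw [Finset.card_pair hab]; exact hj) hjS
  have hT : T ∈ cliquesIn G j S := by
    rw [heq, Finset.mem_powersetCard]
    exact ⟨hT2, hT3⟩
  exact (mem_cliquesIn.1 hT).2 (hT1 (by simp)) (hT1 (by simp)) hab

theorem isClique_insert_nbrsIn {v : V} {S : Finset V} (h : G.IsClique (nbrsIn G v S : Set V)) :
    G.IsClique (insert v (nbrsIn G v S) : Finset V) := by
  rw [Finset.coe_insert, SimpleGraph.isClique_insert]
  exact ⟨h, fun b hb _ => (mem_nbrsIn.1 (Finset.mem_coe.1 hb)).2⟩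

/-- A clique through `v` is `v` together with a clique among its neighbours; this recursion drives
all the counting. -/
theorem card_cliquesIn_insert (j : ℕ) {v : V} {S : Finset V} (hv : v ∉ S) :
    (cliquesIn G (j + 1) (insert v S)).card =
      (cliquesIn G (j + 1) S).card + (cliquesIn G j (nbrsIn G v S)).card := by
  have hinj : Set.InjOn (insert v) (cliquesIn G j (nbrsIn G v S) : Set (Finset V)) := by
    intro A hA B hB hAB
    have hA' : v ∉ A := fun h =>
      hv (nbrsIn_subset v S ((mem_cliquesIn.1 (Finset.mem_coe.1 hA)).1.1 h))
    have hB' : v ∉ B := fun h =>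
      hv (nbrsIn_subset v S ((mem_cliquesIn.1 (Finset.mem_coe.1 hB)).1.1 h))
    rw [← Finset.erase_insert hA', hAB, Finset.erase_insert hB']
  rw [← Finset.card_image_of_injOn hinj, ← Finset.card_union_of_disjoint]
  · congr 1
    ext T
    simp only [Finset.mem_union, Finset.mem_image, mem_cliquesIn]
    constructor
    · rintro ⟨⟨h1, h2⟩, h3⟩
      by_cases hvT : v ∈ T
      · refine Or.inr ⟨T.erase v, ⟨⟨fun x hx => ?_, ?_⟩, ?_⟩, Finset.insert_erase hvT⟩
        · rw [Finset.mem_erase] at hx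
          exact mem_nbrsIn.2 ⟨(Finset.mem_insert.1 (h1 hx.2)).resolve_left hx.1,
            h3 hvT hx.2 (Ne.symm hx.1)⟩
        · rw [Finset.card_erase_of_mem hvT, h2, Nat.add_sub_cancel]
        · exact h3.subset (Finset.coe_subset.2 (Finset.erase_subset _ _))
      · exact Or.inl ⟨⟨(Finset.subset_insert_iff_of_notMem hvT).1 h1, h2⟩, h3⟩
    · rintro (⟨⟨h1, h2⟩, h3⟩ | ⟨A, ⟨⟨h1, h2⟩, h3⟩, rfl⟩)
      · exact ⟨⟨h1.trans (Finset.subset_insert _ _), h2⟩, h3⟩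
      · refine ⟨⟨Finset.insert_subset_insert _ (h1.trans (nbrsIn_subset v S)), ?_⟩, ?_⟩
        · rw [Finset.card_insert_of_notMem (fun h => hv (nbrsIn_subset v S (h1 h))), h2]
        · rw [Finset.coe_insert, SimpleGraph.isClique_insert]
          exact ⟨h3, fun b hb _ => (mem_nbrsIn.1 (h1 hb)).2⟩
  · rw [Finset.disjoint_left]
    intro T hT hT'
    obtain ⟨A, -, rfl⟩ := Finset.mem_image.1 hT'
    exact hv ((mem_cliquesIn.1 hT).1.1 (Finset.mem_insert_self _ _))

theorem card_cliquesIn_one (S : Finset V) : (cliquesIn G 1 S).card = S.card := by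
  have : cliquesIn G 1 S = S.powersetCard 1 := by
    ext T
    rw [mem_cliquesIn, Finset.mem_powersetCard]
    refine ⟨fun h => h.1, fun h => ⟨h, ?_⟩⟩
    obtain ⟨a, rfl⟩ := Finset.card_eq_one.1 h.2
    simp
  rw [this, Finset.card_powersetCard, Nat.choose_one_right]

variable (G) in
/-- The number of edges of `G` inside `S`. -/
noncomputable def edgesIn (S : Finset V) : ℕ := (cliquesIn G 2 S).card

theorem edgesIn_insert {v : V} {S : Finset V} (hv : v ∉ S) :
    edgesIn G (insert v S) = edgesIn G S + (nbrsIn G v S).card := by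
  rw [edgesIn, card_cliquesIn_insert 1 hv, card_cliquesIn_one, edgesIn]

theorem edgesIn_empty : edgesIn G ∅ = 0 :=
  Nat.le_zero.1 (card_cliquesIn_le (G := G) 2 ∅)

theorem edgesIn_singleton (v : V) : edgesIn G {v} = 0 :=
  Nat.le_zero.1 (card_cliquesIn_le (G := G) 2 {v})

theorem edgesIn_of_isClique {S : Finset V} (h : G.IsClique S) : edgesIn G S = S.card.choose 2 :=
  card_cliquesIn_of_isClique 2 h

theorem sum_card_nbrsIn (S : Finset V) : ∑ v ∈ S, (nbrsIn G v S).card = 2 * edgesIn G S := by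
  induction S using Finset.induction_on with
  | empty => simp [edgesIn_empty]
  | insert v S hv ih =>
    rw [Finset.sum_insert hv, edgesIn_insert hv, nbrsIn_insert_self]
    have h1 : ∀ w ∈ S, (nbrsIn G w (insert v S)).card =
        (nbrsIn G w S).card + if w ∈ nbrsIn G v S then 1 else 0 := by
      intro w hw
      split_ifs with h
      · have : nbrsIn G w (insert v S) = insert v (nbrsIn G w S) := by
          ext x
          simp only [mem_nbrsIn, Finset.mem_insert]
          constructor
          · rintro ⟨rfl | hx, hx'⟩
            · exact Or.inl rfl
            · exact Or.inr ⟨hx, hx'⟩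
          · rintro (rfl | hx)
            · exact ⟨Or.inl rfl, (mem_nbrsIn.1 h).2.symm⟩
            · exact ⟨Or.inr hx.1, hx.2⟩
        rw [this, Finset.card_insert_of_notMem fun h => hv (nbrsIn_subset _ _ h)]
      · have : nbrsIn G w (insert v S) = nbrsIn G w S := by
          ext x
          simp only [mem_nbrsIn, Finset.mem_insert]
          constructor
          · rintro ⟨rfl | hx, hx'⟩
            · exact absurd (mem_nbrsIn.2 ⟨hw, hx'.symm⟩) h
            · exact ⟨hx, hx'⟩
          · rintro ⟨hx, hx'⟩
            exact ⟨Or.inr hx, hx'⟩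
        rw [this, add_zero]
    rw [Finset.sum_congr rfl h1, Finset.sum_add_distrib, ih, ← Finset.sum_filter,
      Finset.sum_const, smul_eq_mul, mul_one,
      Finset.filter_mem_eq_inter, Finset.inter_eq_right.2 (nbrsIn_subset v S)]
    ring

variable (G) in
/-- The subgraph induced by `S` is connected. -/
def ConnOn (S : Finset V) : Prop :=
  S.Nonempty ∧ ∀ A ⊆ S, A.Nonempty → A ≠ S → ∃ a ∈ A, ∃ b ∈ S, b ∉ A ∧ G.Adj a b

theorem ConnOn.insert_vertex {S : Finset V} (h : ConnOn G S) {v : V} (hv : (nbrsIn G v S).Nonempty) :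
    ConnOn G (insert v S) := by
  by_cases hvS : v ∈ S
  · rwa [Finset.insert_eq_of_mem hvS]
  obtain ⟨w, hw⟩ := hv
  obtain ⟨hwS, hvw⟩ := mem_nbrsIn.1 hw
  refine ⟨Finset.insert_nonempty _ _, fun A hA hne hAS => ?_⟩
  by_cases hAS' : S ⊆ A
  · have hvA : v ∉ A := fun hvA =>
      hAS (Finset.Subset.antisymm hA (Finset.insert_subset hvA hAS'))
    exact ⟨w, hAS' hwS, v, Finset.mem_insert_self _ _, hvA, hvw.symm⟩
  · by_cases hAe : (A ∩ S).Nonempty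
    · obtain ⟨a, ha, b, hb, hbA, hab⟩ := h.2 (A ∩ S) Finset.inter_subset_right hAe
        (fun h' => hAS' (Finset.inter_eq_right.1 h'))
      exact ⟨a, (Finset.mem_inter.1 ha).1, b, Finset.mem_insert_of_mem hb,
        fun h' => hbA (Finset.mem_inter.2 ⟨h', hb⟩), hab⟩
    · obtain ⟨x, hx⟩ := hne
      have hxv : x = v := by
        rcases Finset.mem_insert.1 (hA hx) with h' | h'
        · exact h'
        · exact absurd ⟨x, Finset.mem_inter.2 ⟨hx, h'⟩⟩ hAe
      subst hxv
      exact ⟨x, hx, w, Finset.mem_insert_of_mem hwS,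
        fun h' => hAe ⟨w, Finset.mem_inter.2 ⟨h', hwS⟩⟩, hvw⟩

theorem connOn_singleton (v : V) : ConnOn G {v} := by
  refine ⟨Finset.singleton_nonempty v, fun A hA hne hA' => ?_⟩
  rcases Finset.subset_singleton_iff.1 hA with rfl | rfl
  · exact absurd hne (by simp)
  · exact absurd rfl hA'

theorem connOn_of_isClique {S : Finset V} (h : G.IsClique S) (hne : S.Nonempty) : ConnOn G S := by
  refine ⟨hne, fun A hA hAne hAS => ?_⟩
  obtain ⟨a, ha⟩ := hAne
  obtain ⟨b, hb, hbA⟩ := Finset.exists_of_ssubset (hA.ssubset_of_ne hAS)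
  exact ⟨a, ha, b, hb, hbA, h (hA ha) hb fun h' => hbA (h' ▸ ha)⟩

theorem ConnOn.exists_nbr {S Y : Finset V} (h : ConnOn G S) (hY : Y ⊆ S) (hne : Y.Nonempty)
    (hYS : Y ≠ S) : ∃ w ∈ S, w ∉ Y ∧ (nbrsIn G w Y).Nonempty := by
  obtain ⟨a, ha, b, hb, hbY, hab⟩ := h.2 Y hY hne hYS
  exact ⟨b, hb, hbY, a, mem_nbrsIn.2 ⟨ha, hab.symm⟩⟩

/-- A connected vertex set is obtained from any of its connected subsets by adding vertices one
at a time, each adjacent to one of the earlier ones. -/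
theorem ConnOn.growth {S Y : Finset V} (hS : ConnOn G S) (hY : ConnOn G Y) (hYS : Y ⊆ S)
    {P : Finset V → Prop} (h0 : P Y)
    (hstep : ∀ Z v, Y ⊆ Z → insert v Z ⊆ S → v ∉ Z → ConnOn G Z → (nbrsIn G v Z).Nonempty → P Z →
      P (insert v Z)) : P S := by
  have key : ∀ a Z, (S \ Z).card = a → Y ⊆ Z → Z ⊆ S → ConnOn G Z → P Z → P S := by
    intro a
    induction a with
    | zero =>
      intro Z hZ _ hZS _ hP
      rw [Finset.card_eq_zero, Finset.sdiff_eq_empty_iff_subset] at hZ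
      rwa [Finset.Subset.antisymm hZ hZS]
    | succ a ih =>
      intro Z hZ hYZ hZS hc hP
      have hne : Z ≠ S := by
        rintro rfl
        simp at hZ
      obtain ⟨w, hw, hwZ, hwn⟩ := hS.exists_nbr hZS hc.1 hne
      have hsub : insert w Z ⊆ S := Finset.insert_subset hw hZS
      refine ih (insert w Z) ?_ (hYZ.trans (Finset.subset_insert _ _)) hsub (hc.insert_vertex hwn)
        (hstep Z w hYZ hsub hwZ hc hwn hP)
      have h1 := Finset.card_sdiff_add_card_eq_card hsub
      have h2 := Finset.card_sdiff_add_card_eq_card hZS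
      rw [Finset.card_insert_of_notMem hwZ] at h1
      omega
  exact key _ Y rfl le_rfl hYS hY h0

/-- Monotonicity of the cyclomatic number |E| − |S| + 1, written without subtraction: each vertex
added during growth brings at least one edge. -/
theorem ConnOn.edgesIn_mono {S Y : Finset V} (hS : ConnOn G S) (hY : ConnOn G Y) (hYS : Y ⊆ S) :
    edgesIn G Y + S.card ≤ edgesIn G S + Y.card := by
  refine hS.growth hY hYS (P := fun Z => edgesIn G Y + Z.card ≤ edgesIn G Z + Y.card) le_rfl ?_
  intro Z v _ _ hv _ hne ih
  rw [edgesIn_insert hv, Finset.card_insert_of_notMem hv]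
  have := hne.card_pos
  omega

theorem ConnOn.card_le {S : Finset V} (hS : ConnOn G S) : S.card ≤ edgesIn G S + 1 := by
  obtain ⟨v, hv⟩ := hS.1
  have := hS.edgesIn_mono (connOn_singleton v) (Finset.singleton_subset_iff.2 hv)
  rw [edgesIn_singleton, Finset.card_singleton] at this
  omega

/-- A clique cannot meet both sides outside the cut vertex, and none of size at least 2 fits in the
one-vertex intersection. -/
theorem card_cliquesIn_union {A B : Finset V} {v : V} (hAB : A ∩ B = {v})
    (h : ∀ a ∈ A, ∀ b ∈ B, a ≠ v → b ≠ v → ¬ G.Adj a b) {j : ℕ} (hj : 2 ≤ j) :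
    (cliquesIn G j (A ∪ B)).card = (cliquesIn G j A).card + (cliquesIn G j B).card := by
  have hvA : v ∈ A := (Finset.mem_inter.1 (hAB ▸ Finset.mem_singleton_self v)).1
  have hvB : v ∈ B := (Finset.mem_inter.1 (hAB ▸ Finset.mem_singleton_self v)).2
  rw [← Finset.card_union_of_disjoint]
  · congr 1
    ext T
    rw [Finset.mem_union, mem_cliquesIn, mem_cliquesIn, mem_cliquesIn]
    constructor
    · rintro ⟨⟨h1, h2⟩, h3⟩
      by_cases hTA : T ⊆ A
      · exact Or.inl ⟨⟨hTA, h2⟩, h3⟩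
      · refine Or.inr ⟨⟨fun y hy => ?_, h2⟩, h3⟩
        obtain ⟨x, hx, hxA⟩ := Finset.not_subset.1 hTA
        have hxB : x ∈ B := (Finset.mem_union.1 (h1 hx)).resolve_left hxA
        by_contra hyB
        have hyA : y ∈ A := (Finset.mem_union.1 (h1 hy)).resolve_right hyB
        refine h y hyA x hxB ?_ ?_ (h3 hy hx ?_)
        · rintro rfl; exact hyB hvB
        · rintro rfl; exact hxA hvA
        · rintro rfl; exact hxA hyA
    · rintro (⟨⟨h1, h2⟩, h3⟩ | ⟨⟨h1, h2⟩, h3⟩)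
      · exact ⟨⟨h1.trans Finset.subset_union_left, h2⟩, h3⟩
      · exact ⟨⟨h1.trans Finset.subset_union_right, h2⟩, h3⟩
  · rw [Finset.disjoint_left]
    intro T hT hT'
    have h1 := Finset.card_le_card
      (Finset.subset_inter (mem_cliquesIn.1 hT).1.1 (mem_cliquesIn.1 hT').1.1)
    rw [hAB, Finset.card_singleton, (mem_cliquesIn.1 hT).1.2] at h1
    omega

/-- A connected vertex set splits along a cut vertex into two smaller connected sets. -/
theorem ConnOn.split {S : Finset V} (hS : ConnOn G S) {v : V} (hv : v ∈ S) (hcard : 2 ≤ S.card)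
    (hnc : ¬ ConnOn G (S.erase v)) :
    ∃ A B, A ∪ B = S ∧ A ∩ B = {v} ∧ A.card < S.card ∧ B.card < S.card ∧
      (∀ a ∈ A, ∀ b ∈ B, a ≠ v → b ≠ v → ¬ G.Adj a b) ∧ ConnOn G A ∧ ConnOn G B := by
  have hne : (S.erase v).Nonempty := by
    rw [← Finset.card_pos, Finset.card_erase_of_mem hv]
    omega
  have : ∃ C ⊆ S.erase v, C.Nonempty ∧ C ≠ S.erase v ∧
      ∀ a ∈ C, ∀ b ∈ S.erase v, b ∉ C → ¬ G.Adj a b := by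
    by_contra hcon
    refine hnc ⟨hne, fun A hA hAne hAS => ?_⟩
    by_contra hcon2
    refine hcon ⟨A, hA, hAne, hAS, fun a ha b hb hbA hab => hcon2 ⟨a, ha, b, hb, hbA, hab⟩⟩
  obtain ⟨C, hC, hCne, hCS, hCadj⟩ := this
  -- Stated for any union of components of `S.erase v`, so that it serves both `C` and its
  -- complement.
  have main : ∀ C ⊆ S.erase v, C.Nonempty →
      (∀ a ∈ C, ∀ b ∈ S.erase v, b ∉ C → ¬ G.Adj a b) → ConnOn G (insert v C) := by
    intro C hC hCne hCadj
    have hvC : v ∉ C := fun h => Finset.notMem_erase v S (hC h)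
    have hCS : C ⊆ S := hC.trans (Finset.erase_subset _ _)
    have aux : ∀ D ⊆ C, D.Nonempty → ∃ a ∈ D, ∃ b ∈ insert v C, b ∉ D ∧ G.Adj a b := by
      intro D hD hDne
      obtain ⟨a, ha, b, hb, hbD, hab⟩ := hS.2 D (hD.trans hCS) hDne
        (fun h' => hvC (hD (h' ▸ hv)))
      refine ⟨a, ha, b, ?_, hbD, hab⟩
      by_contra hb'
      rw [Finset.mem_insert, not_or] at hb'
      exact hCadj a (hD ha) b (Finset.mem_erase.2 ⟨hb'.1, hb⟩) hb'.2 hab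
    refine ⟨Finset.insert_nonempty _ _, fun D hD hDne hDC => ?_⟩
    by_cases hvD : v ∈ D
    -- When `D` contains `v`, look for the crossing edge from the complement, which avoids `v`, and
    -- reverse it.
    · obtain ⟨a, ha, b, hb, hbD, hab⟩ := aux (C \ D) Finset.sdiff_subset (by
        rw [Finset.sdiff_nonempty]
        exact fun h' => hDC (Finset.Subset.antisymm hD (Finset.insert_subset hvD h')))
      refine ⟨b, ?_, a, Finset.mem_insert_of_mem (Finset.mem_sdiff.1 ha).1,
        (Finset.mem_sdiff.1 ha).2, hab.symm⟩
      rcases Finset.mem_insert.1 hb with rfl | hb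
      · exact hvD
      · by_contra h'
        exact hbD (Finset.mem_sdiff.2 ⟨hb, h'⟩)
    · exact aux D ((Finset.subset_insert_iff_of_notMem hvD).1 hD) hDne
  have hvC : v ∉ C := fun h => Finset.notMem_erase v S (hC h)
  have hC1 : C.card < (S.erase v).card := Finset.card_lt_card (hC.ssubset_of_ne hCS)
  have hC2 := hCne.card_pos
  have hC3 := Finset.card_sdiff_add_card_eq_card hC
  have hC4 := Finset.card_erase_of_mem hv
  refine ⟨insert v C, insert v (S.erase v \ C), ?_, ?_, ?_, ?_, ?_, main C hC hCne hCadj,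
    main _ Finset.sdiff_subset ?_ ?_⟩
  · rw [← Finset.insert_union_distrib, Finset.union_sdiff_of_subset hC, Finset.insert_erase hv]
  · rw [← Finset.insert_inter_distrib, Finset.inter_sdiff_self]
    simp
  · rw [Finset.card_insert_of_notMem hvC]; omega
  · rw [Finset.card_insert_of_notMem (fun h => by simp at h)]; omega
  · intro a ha b hb hav hbv
    have ha' := (Finset.mem_insert.1 ha).resolve_left hav
    have hb' := Finset.mem_sdiff.1 ((Finset.mem_insert.1 hb).resolve_left hbv)
    exact hCadj a ha' b hb'.1 hb'.2
  · rw [← Finset.card_pos]; omega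
  · intro a ha b hb hb' hab
    have hbC : b ∈ C := by
      by_contra h'
      exact hb' (Finset.mem_sdiff.2 ⟨hb, h'⟩)
    exact hCadj b hbC a (Finset.mem_sdiff.1 ha).1 (Finset.mem_sdiff.1 ha).2 hab.symm

end Local

/-! ### The upper bound and its equality case -/

section Bound

variable {V : Type*} [DecidableEq V] {G : SimpleGraph V}

theorem le_triIndex {q b : ℕ} (h : q.choose 2 ≤ b) : q ≤ triIndex b := by
  rcases Nat.eq_zero_or_pos q with rfl | hq
  · exact Nat.zero_le _
  · have h1 := triIndex_mono h
    rwa [← add_zero (q.choose 2), triIndex_eq hq] at h1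

theorem two_mul_choose_two (n : ℕ) : 2 * n.choose 2 = n * (n - 1) := by
  rw [Nat.choose_two_right, Nat.mul_div_cancel' (Nat.even_mul_pred_self n).two_dvd]

theorem ConnOn.card_nbrsIn_pos {S : Finset V} (hS : ConnOn G S) (hcard : 2 ≤ S.card) {v : V}
    (hv : v ∈ S) : 0 < (nbrsIn G v S).card := by
  obtain ⟨a, ha, b, hb, hba, hab⟩ := hS.2 {v} (Finset.singleton_subset_iff.2 hv)
    (Finset.singleton_nonempty v) (by
      rintro rfl
      simp at hcard)
  rw [Finset.mem_singleton] at ha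
  subst ha
  exact Finset.card_pos.2 ⟨b, mem_nbrsIn.2 ⟨hb, hab⟩⟩

theorem card_nbrsIn_lt {S : Finset V} {v : V} (hv : v ∈ S) : (nbrsIn G v S).card < S.card :=
  Finset.card_lt_card ((Finset.ssubset_iff_of_subset (nbrsIn_subset v S)).2
    ⟨v, hv, fun h => G.irrefl (mem_nbrsIn.1 h).2⟩)

/-- A connected graph of cyclomatic number `b` and with minimum degree `l + 1` has
`b ≥ (l + 1).choose 2`. -/
theorem succ_choose_two_le_of_minDegree {S : Finset V} {b l : ℕ} (hne : S.Nonempty)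
    (hb : edgesIn G S + 1 = S.card + b) (h : ∀ v ∈ S, l + 1 ≤ (nbrsIn G v S).card) :
    (l + 1).choose 2 ≤ b := by
  obtain ⟨v, hv⟩ := hne
  have h1 := (h v hv).trans_lt (card_nbrsIn_lt hv)
  have h2 : S.card * (l + 1) ≤ 2 * edgesIn G S := by
    rw [← sum_card_nbrsIn, ← smul_eq_mul]
    exact Finset.card_nsmul_le_sum _ _ _ h
  have h3 := two_mul_choose_two (l + 1)
  rw [Nat.add_sub_cancel] at h3
  obtain ⟨c, hc⟩ := Nat.exists_eq_add_of_le h1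
  rw [hc] at h2 hb
  -- For l ≥ 1: 2b ≥ |S|(l−1) + 2 ≥ (l+2)(l−1) + 2 = (l+1)l. The use of |S| ≥ l + 2 needs l − 1 ≥ 0,
  -- hence the split.
  have h4 : l = 0 ∨ 1 ≤ l := by omega
  rcases h4 with rfl | h4
  · simp
  · nlinarith

/-- The bound and the existence of the large clique are proved in one induction, since the equality
case for a part is needed for the whole. Positivity is essential: when the bound is 0, equality
carries no information. -/
theorem card_cliquesIn_le_maxCliques {k : ℕ} (hk : 2 ≤ k) (S : Finset V) (hS : ConnOn G S) (b : ℕ)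
    (hb : edgesIn G S + 1 = S.card + b) :
    (cliquesIn G (k + 1) S).card ≤ maxCliques k b ∧
      ((cliquesIn G (k + 1) S).card = maxCliques k b → 0 < maxCliques k b →
        ∃ K ⊆ S, G.IsClique (K : Set V) ∧ K.card = triIndex b + 1) := by
  induction hn : S.card using Nat.strong_induction_on generalizing S b with
  | _ n ih =>
  subst hn
  rcases Nat.lt_or_ge S.card 2 with hcard | hcard
  · have h0 : (cliquesIn G (k + 1) S).card = 0 := by
      have := card_cliquesIn_le (G := G) (k + 1) S
      rwa [Nat.choose_eq_zero_of_lt (by omega), Nat.le_zero] at this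
    rw [h0]
    exact ⟨Nat.zero_le _, fun h h' => absurd h h'.ne⟩
  by_cases hcut : ∃ v ∈ S, ¬ ConnOn G (S.erase v)
  · obtain ⟨v, hv, hnc⟩ := hcut
    obtain ⟨A, B, hAB, hint, hA, hB, hadj, hcA, hcB⟩ := hS.split hv hcard hnc
    have hc := Finset.card_union_add_card_inter A B
    rw [hint, hAB, Finset.card_singleton] at hc
    have hk2 := card_cliquesIn_union hint hadj (j := k + 1) (by omega)
    have he : edgesIn G S = edgesIn G A + edgesIn G B := by
      have := card_cliquesIn_union hint hadj (j := 2) le_rfl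
      rwa [hAB] at this
    rw [hAB] at hk2
    obtain ⟨x, hx⟩ := Nat.exists_eq_add_of_le hcA.card_le
    obtain ⟨y, hy⟩ := Nat.exists_eq_add_of_le hcB.card_le
    obtain ⟨h1, h2⟩ := ih A.card hA A hcA x hx rfl
    obtain ⟨h3, h4⟩ := ih B.card hB B hcB y hy rfl
    have hAS : A ⊆ S := hAB ▸ Finset.subset_union_left
    have hBS : B ⊆ S := hAB ▸ Finset.subset_union_right
    rw [hk2]
    rcases le_total y x with hxy | hxy
    · obtain rfl : b = x + y := by omega
      obtain ⟨h5, h6⟩ := maxCliques_add_le hk y x hxy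
      refine ⟨by omega, fun heq hpos => ?_⟩
      obtain ⟨h7, h8⟩ := h6 (by omega) hpos
      obtain ⟨K, hK, hK'⟩ := h2 (by omega) h8
      exact ⟨K, hK.trans hAS, hK'.1, by rw [h7, hK'.2]⟩
    · obtain rfl : b = y + x := by omega
      obtain ⟨h5, h6⟩ := maxCliques_add_le hk x y hxy
      refine ⟨by omega, fun heq hpos => ?_⟩
      obtain ⟨h7, h8⟩ := h6 (by omega) hpos
      obtain ⟨K, hK, hK'⟩ := h4 (by omega) h8
      exact ⟨K, hK.trans hBS, hK'.1, by rw [h7, hK'.2]⟩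
  -- No cut vertex, so deleting a vertex of minimum degree keeps the graph connected and the
  -- induction applies.
  · push Not at hcut
    obtain ⟨v, hv, hmin⟩ := Finset.exists_min_image S (fun v => (nbrsIn G v S).card) hS.1
    have hd := hS.card_nbrsIn_pos hcard hv
    obtain ⟨l, hl⟩ := Nat.exists_eq_add_of_le' (show 1 ≤ _ from hd)
    have hS' : insert v (S.erase v) = S := Finset.insert_erase hv
    have hv' : v ∉ S.erase v := Finset.notMem_erase v S
    have hN : nbrsIn G v (S.erase v) = nbrsIn G v S := by
      rw [← nbrsIn_insert_self, hS']
    have he := edgesIn_insert (G := G) hv'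
    have hk2 := card_cliquesIn_insert (G := G) k hv'
    rw [hS', hN] at he hk2
    have hc := Finset.card_erase_of_mem hv
    have hconn := hcut v hv
    obtain ⟨a, ha⟩ := Nat.exists_eq_add_of_le hconn.card_le
    obtain rfl : b = a + l := by omega
    have hlow := succ_choose_two_le_of_minDegree hS.1 hb (fun w hw => hl ▸ hmin w hw)
    rw [succ_choose_two] at hlow
    obtain ⟨h1, h2⟩ := ih _ (by omega) (S.erase v) hconn a ha rfl
    obtain ⟨h3, h4⟩ := maxCliques_add_choose_le hk (le_triIndex (show l.choose 2 ≤ a by omega))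
    have h5 := card_cliquesIn_le (G := G) k (nbrsIn G v S)
    rw [hl] at h5
    rw [hk2]
    refine ⟨by omega, fun heq hpos => ?_⟩
    rcases h4 (by omega) hpos with ⟨h6, h7, h8⟩ | ⟨h6, h7⟩
    -- All C(l+1,k) possible cliques through `v` are present, so its neighbourhood is a clique and
    -- together with `v` has the required size.
    · have hcl := isClique_of_card_cliquesIn (G := G) (S := nbrsIn G v S) hk (by omega)
        (by rw [hl]; omega)
      refine ⟨insert v (nbrsIn G v S), Finset.insert_subset hv (nbrsIn_subset _ _),
        isClique_insert_nbrsIn hcl, ?_⟩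
      rw [Finset.card_insert_of_notMem (fun h => G.irrefl (mem_nbrsIn.1 h).2)]
      omega
    · obtain ⟨K, hK, hK'⟩ := h2 (by omega) h7
      exact ⟨K, hK.trans (Finset.erase_subset _ _), hK'.1, by rw [h6, hK'.2]⟩

/-- In a connected graph containing a clique `K`, few cliques have a vertex outside `K`. -/
theorem card_cliquesIn_le_of_isClique_subset {k : ℕ} (hk : 2 ≤ k) {K S : Finset V}
    (hS : ConnOn G S) (hK : G.IsClique (K : Set V)) (hne : K.Nonempty) (hKS : K ⊆ S) :
    ∀ u, edgesIn G S + K.card = edgesIn G K + S.card + u →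
      (cliquesIn G (k + 1) S).card ≤ (cliquesIn G (k + 1) K).card + (u + 1).choose k := by
  refine hS.growth (connOn_of_isClique hK hne) hKS (P := fun S => ∀ u,
    edgesIn G S + K.card = edgesIn G K + S.card + u →
      (cliquesIn G (k + 1) S).card ≤ (cliquesIn G (k + 1) K).card + (u + 1).choose k) ?_ ?_
  · intro u _
    omega
  · intro Z v hYZ _ hv hZ hn ih u hu
    have hmono := hZ.edgesIn_mono (connOn_of_isClique hK hne) hYZ
    obtain ⟨l, hl⟩ := Nat.exists_eq_add_of_le' (show 1 ≤ _ from hn.card_pos)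
    rw [edgesIn_insert hv, Finset.card_insert_of_notMem hv] at hu
    obtain ⟨w, rfl⟩ : ∃ w, u = w + l := ⟨u - l, by omega⟩
    have h1 := ih w (by omega)
    have h2 := card_cliquesIn_le (G := G) k (nbrsIn G v Z)
    have h3 := choose_succ_add_le hk w l
    rw [hl] at h2
    rw [card_cliquesIn_insert k hv]
    omega

/-- When a connected graph containing a clique `K` has as many cliques with a vertex outside `K` as
possible, some vertex outside `K` has many neighbours in `K`, or there is just one triangle. -/
theorem exists_vertex_of_card_cliquesIn_eq {k : ℕ} (hk : 2 ≤ k) {K S : Finset V}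
    (hS : ConnOn G S) (hK : G.IsClique (K : Set V)) (hne : K.Nonempty) (hKS : K ⊆ S) :
    ∀ u, k ≤ u + 1 → edgesIn G S + K.card = edgesIn G K + S.card + u →
      (cliquesIn G (k + 1) S).card = (cliquesIn G (k + 1) K).card + (u + 1).choose k →
      (∃ w ∈ S, w ∉ K ∧ u + 1 ≤ (nbrsIn G w K).card) ∨ (k = 2 ∧ u = 1) := by
  refine hS.growth (connOn_of_isClique hK hne) hKS (P := fun S => ∀ u, k ≤ u + 1 →
    edgesIn G S + K.card = edgesIn G K + S.card + u →
      (cliquesIn G (k + 1) S).card = (cliquesIn G (k + 1) K).card + (u + 1).choose k →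
      (∃ w ∈ S, w ∉ K ∧ u + 1 ≤ (nbrsIn G w K).card) ∨ (k = 2 ∧ u = 1)) ?_ ?_
  · intro u hku hu
    omega
  · intro Z v hYZ _ hv hZ hn ih u hku hu heq
    have hmono := hZ.edgesIn_mono (connOn_of_isClique hK hne) hYZ
    obtain ⟨l, hl⟩ := Nat.exists_eq_add_of_le' (show 1 ≤ _ from hn.card_pos)
    rw [edgesIn_insert hv, Finset.card_insert_of_notMem hv] at hu
    obtain ⟨w, rfl⟩ : ∃ w, u = w + l := ⟨u - l, by omega⟩
    have h1 := card_cliquesIn_le_of_isClique_subset hk hZ hK hne hYZ w (by omega)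
    have h2 := card_cliquesIn_le (G := G) k (nbrsIn G v Z)
    have h3 := choose_succ_add_le hk w l
    rw [hl] at h2
    rw [card_cliquesIn_insert k hv] at heq
    rcases Nat.eq_zero_or_pos l with rfl | hl0
    -- A vertex with one earlier neighbour lies in no new clique, as k ≥ 2, and uses no excess.
    · rw [Nat.choose_eq_zero_of_lt (show 0 + 1 < k by omega)] at h2
      simp only [add_zero] at heq
      rcases ih w hku (by omega) (by omega) with ⟨x, hx, hx'⟩ | h
      · exact Or.inl ⟨x, Finset.mem_insert_of_mem hx, hx'⟩
      · exact Or.inr h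
    · rcases Nat.eq_zero_or_pos w with rfl | hw0
      · rw [zero_add] at heq hku ⊢
        have hz : (0 + 1).choose k = 0 := Nat.choose_eq_zero_of_lt (by omega)
        rw [hz] at h1
        have hcl : G.IsClique (nbrsIn G v Z : Set V) :=
          isClique_of_card_cliquesIn hk (by omega) (by rw [hl]; omega)
        by_cases hl1 : l = 1
        · subst hl1
          exact Or.inr ⟨by omega, rfl⟩
        · left
          refine ⟨v, Finset.mem_insert_self _ _, fun h => hv (hYZ h), ?_⟩
          rw [← hl]
          refine Finset.card_le_card fun y hy => mem_nbrsIn.2 ⟨?_, (mem_nbrsIn.1 hy).2⟩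
          -- With no excess before `v`, every triangle of `Z` lies in `K`. Since `v` has at least
          -- three neighbours and they form a clique, each of them lies in such a triangle.
          have ht := card_cliquesIn_le_of_isClique_subset (k := 2) le_rfl hZ hK hne hYZ 0 (by omega)
          rw [Nat.choose_eq_zero_of_lt (show 0 + 1 < 2 by omega), add_zero] at ht
          have heq3 := Finset.eq_of_subset_of_card_le (cliquesIn_mono (G := G) (2 + 1) hYZ) ht
          obtain ⟨T, hT1, hT2, hT3⟩ := Finset.exists_subsuperset_card_eq (s := {y})
            (t := nbrsIn G v Z) (n := 3) (Finset.singleton_subset_iff.2 hy)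
            (by simp) (by omega)
          have hT : T ∈ cliquesIn G (2 + 1) Z := mem_cliquesIn.2
            ⟨⟨hT2.trans (nbrsIn_subset _ _), hT3⟩, hcl.subset (Finset.coe_subset.2 hT2)⟩
          rw [← heq3] at hT
          exact (mem_cliquesIn.1 hT).1.1 (hT1 (Finset.mem_singleton_self y))
      -- Excess shared between `v` and the earlier vertices makes superadditivity strict.
      · have := choose_succ_add_lt hk hw0 hl0 (by omega)
        omega

end Bound

/-! ### Cores and the excess they require -/

section Structure

variable {V : Type*} [DecidableEq V] {G : SimpleGraph V}

/-- The last vertex added when growing `Y` to `S` can be removed without disconnecting. -/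
theorem ConnOn.exists_erase {S Y : Finset V} (hS : ConnOn G S) (hY : ConnOn G Y) (hYS : Y ⊆ S)
    (hne : Y ≠ S) : ∃ v ∈ S, v ∉ Y ∧ ConnOn G (S.erase v) := by
  have := hS.growth hY hYS (P := fun Z => Z = Y ∨ ∃ v ∈ Z, v ∉ Y ∧ ConnOn G (Z.erase v))
    (Or.inl rfl) (fun Z v hYZ _ hv hZ _ _ => Or.inr ⟨v, Finset.mem_insert_self _ _,
      fun h => hv (hYZ h), by rwa [Finset.erase_insert hv]⟩)
  exact this.resolve_left (Ne.symm hne)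

/-- Vertices of degree at least `d + 1` outside a connected set `Y` add at least `d` to the
cyclomatic number. -/
theorem ConnOn.add_le_of_minDegree {Y R : Finset V} {d : ℕ} (hY : ConnOn G Y)
    (hR : ∃ x ∈ R, x ∉ Y) (hd : ∀ x ∈ R, x ∉ Y → d + 1 ≤ (nbrsIn G x R).card)
    (S : Finset V) (hS : ConnOn G S) (hYS : Y ⊆ S) (hRS : R ⊆ S) :
    edgesIn G Y + S.card + d ≤ edgesIn G S + Y.card := by
  induction hn : S.card using Nat.strong_induction_on generalizing S with
  | _ n ih =>
  subst hn
  obtain ⟨x, hxR, hxY⟩ := hR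
  have hne : Y ≠ S := by
    rintro rfl
    exact hxY (hRS hxR)
  obtain ⟨v, hv, hvY, hc⟩ := hS.exists_erase hY hYS hne
  have hYS' : Y ⊆ S.erase v := fun y hy =>
    Finset.mem_erase.2 ⟨fun h => hvY (h ▸ hy), hYS hy⟩
  have hv' : v ∉ S.erase v := Finset.notMem_erase v S
  have hS' : insert v (S.erase v) = S := Finset.insert_erase hv
  have he := edgesIn_insert (G := G) hv'
  rw [← nbrsIn_insert_self, hS'] at he
  have hcard := Finset.card_erase_add_one hv
  -- Peel `S` towards `Y`. The first removed vertex of `R` still sees all its neighbours in `R`, so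
  -- its removal drops the cyclomatic number by at least `d`; earlier removals keep `R` inside `S`.
  by_cases hvR : v ∈ R
  · have h1 := hd v hvR hvY
    have h2 := card_nbrsIn_mono (G := G) v hRS
    have h3 := hc.edgesIn_mono hY hYS'
    omega
  · have h1 := ih _ (by omega) (S.erase v) hc hYS' (fun y hy =>
      Finset.mem_erase.2 ⟨fun h => hvR (h ▸ hy), hRS hy⟩) rfl
    have h2 := hS.card_nbrsIn_pos (by have := hc.1.card_pos; omega) hv
    omega

theorem nonempty_induce_iso {R : Set V} {N : ℕ} {H : SimpleGraph (Fin N)} (f : ℕ → V)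
    (hmem : ∀ i < N, f i ∈ R) (hsurj : ∀ x ∈ R, ∃ i < N, f i = x)
    (hinj : ∀ i j, i < j → j < N → f i ≠ f j)
    (hadj : ∀ i j, ∀ (hij : i < j) (hj : j < N),
      G.Adj (f i) (f j) ↔ H.Adj ⟨i, hij.trans hj⟩ ⟨j, hj⟩) :
    Nonempty (G.induce R ≃g H) := by
  let g : Fin N → R := fun i => ⟨f i, hmem i i.2⟩
  have hg : Function.Bijective g := by
    constructor
    · intro i j hij
      have hij' : f i = f j := congrArg Subtype.val hij
      rcases lt_trichotomy i.1 j.1 with h | h | h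
      · exact absurd hij' (hinj _ _ h j.2)
      · exact Fin.ext h
      · exact absurd hij'.symm (hinj _ _ h i.2)
    · rintro ⟨x, hx⟩
      obtain ⟨i, hi, hix⟩ := hsurj x hx
      exact ⟨⟨i, hi⟩, Subtype.ext hix⟩
  refine ⟨(RelIso.symm ⟨Equiv.ofBijective g hg, ?_⟩ : G.induce R ≃g H)⟩
  intro i j
  change G.Adj (f i) (f j) ↔ H.Adj i j
  rcases lt_trichotomy i.1 j.1 with h | h | h
  · exact hadj _ _ h j.2
  · rw [Fin.ext h]
    simp
  · rw [G.adj_comm, H.adj_comm]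
    exact hadj _ _ h i.2

theorem exists_enumeration {A B : Finset V} (hAB : A ⊆ B) (hB : B.Nonempty) :
    ∃ f : ℕ → V, (∀ i j, i < j → j < B.card → f i ≠ f j) ∧ (∀ i < A.card, f i ∈ A) ∧
      (∀ i < B.card, f i ∈ B) ∧ (∀ x ∈ B, ∃ i < B.card, f i = x) ∧
      ∀ i, A.card ≤ i → i < B.card → f i ∉ A := by
  obtain ⟨b, -⟩ := hB
  set L := A.toList ++ (B \ A).toList with hL
  have hlen : L.length = B.card := by
    rw [hL, List.length_append, Finset.length_toList, Finset.length_toList, add_comm,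
      Finset.card_sdiff_add_card_eq_card hAB]
  have hnd : L.Nodup := by
    rw [hL, List.nodup_append']
    refine ⟨A.nodup_toList, (B \ A).nodup_toList, fun x hx hx' => ?_⟩
    rw [Finset.mem_toList] at hx hx'
    exact (Finset.mem_sdiff.1 hx').2 hx
  have hmem : ∀ x, x ∈ L ↔ x ∈ B := by
    intro x
    rw [hL, List.mem_append, Finset.mem_toList, Finset.mem_toList, Finset.mem_sdiff]
    exact ⟨fun h => h.elim (fun h => hAB h) (fun h => h.1), fun h => by tauto⟩
  have hget : ∀ i, ∀ h : i < B.card, L.getD i b = L[i]'(hlen ▸ h) := fun i h =>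
    List.getD_eq_getElem _ _ _
  have hfst : ∀ i < A.card, L.getD i b ∈ A := by
    intro i hi
    rw [hget i (hi.trans_le (Finset.card_le_card hAB))]
    have : L[i]'(hlen ▸ hi.trans_le (Finset.card_le_card hAB)) =
        A.toList[i]'(by rwa [Finset.length_toList]) :=
      List.getElem_append_left (by rwa [Finset.length_toList])
    rw [this, ← Finset.mem_toList]
    exact List.getElem_mem _
  have hinj : ∀ i j, i < j → j < B.card → L.getD i b ≠ L.getD j b := by
    intro i j hij hj h
    rw [hget i (hij.trans hj), hget j hj, hnd.getElem_inj_iff] at h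
    omega
  refine ⟨fun i => L.getD i b, hinj, hfst, ?_, ?_, ?_⟩
  · intro i hi
    change L.getD i b ∈ B
    rw [hget i hi, ← hmem]
    exact List.getElem_mem _
  · intro x hx
    obtain ⟨i, hi, h⟩ := List.getElem_of_mem ((hmem x).2 hx)
    exact ⟨i, hlen ▸ hi, (hget i (hlen ▸ hi)).trans h⟩
  · intro i hi hiB h
    have himg : (Finset.range A.card).image (fun i => L.getD i b) = A := by
      refine Finset.eq_of_subset_of_card_le (fun x hx => ?_) ?_
      · obtain ⟨j, hj, rfl⟩ := Finset.mem_image.1 hx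
        exact hfst j (Finset.mem_range.1 hj)
      · rw [Finset.card_image_of_injOn, Finset.card_range]
        intro x hx y hy hxy
        simp only [Finset.coe_range, Set.mem_Iio] at hx hy
        have := Finset.card_le_card hAB
        rcases lt_trichotomy x y with h' | h' | h'
        · exact absurd hxy (hinj _ _ h' (by omega))
        · exact h'
        · exact absurd hxy.symm (hinj _ _ h' (by omega))
    rw [← himg] at h
    obtain ⟨j, hj, hji⟩ := Finset.mem_image.1 h
    exact hinj j i ((Finset.mem_range.1 hj).trans_le hi) hiB hji

/-- `R` is the vertex set of the subgraph left after deleting vertices of degree less than `d`. -/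
def IsCore (G : SimpleGraph V) (d : ℕ) (R : Finset V) : Prop :=
  (∀ v ∈ R, d ≤ (nbrsIn G v R).card) ∧
    ∀ T : Finset V, (∀ v ∈ T, d ≤ (nbrsIn G v T).card) → T ⊆ R

theorem nbrsIn_of_isClique {K : Finset V} (hK : G.IsClique (K : Set V)) {v : V} (hv : v ∈ K) :
    nbrsIn G v K = K.erase v := by
  ext x
  rw [mem_nbrsIn, Finset.mem_erase]
  refine ⟨fun h => ⟨?_, h.1⟩, fun h => ⟨h.2, hK hv h.2 (Ne.symm h.1)⟩⟩
  rintro rfl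
  exact G.irrefl h.2

theorem IsCore.clique_subset {d : ℕ} {R K : Finset V} (hR : IsCore G d R)
    (hK : G.IsClique (K : Set V)) (hcard : d + 1 ≤ K.card) : K ⊆ R := by
  refine hR.2 K fun v hv => ?_
  rw [nbrsIn_of_isClique hK hv, Finset.card_erase_of_mem hv]
  omega

/-- The core of a connected graph with the most cliques. -/
theorem IsCore.structure_of_card_eq {k q u : ℕ} (hk : 2 ≤ k) {R S : Finset V} (hR : IsCore G k R)
    (hRS : R ⊆ S) (hS : ConnOn G S) (hu : u < q)
    (hb : edgesIn G S + 1 = S.card + (q.choose 2 + u))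
    (heq : (cliquesIn G (k + 1) S).card = maxCliques k (q.choose 2 + u))
    (hpos : 0 < maxCliques k (q.choose 2 + u)) :
    ∃ K ⊆ R, G.IsClique (K : Set V) ∧ K.card = q + 1 ∧ k ≤ q ∧
      edgesIn G S + K.card = edgesIn G K + S.card + u ∧
      (u + 1 < k → R = K) ∧
      (k ≤ u + 1 → (∃ w, w ∉ K ∧ R = insert w K ∧ (nbrsIn G w K).card = u + 1) ∨
        (k = 2 ∧ u = 1 ∧ ∀ w, w ∉ K → (nbrsIn G w K).card ≤ 1)) := by
  obtain ⟨K, hKS, hK, hKc⟩ := (card_cliquesIn_le_maxCliques hk S hS _ hb).2 heq hpos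
  rw [triIndex_eq hu] at hKc
  rw [maxCliques_of_lt k hu] at heq hpos
  have hkq : k ≤ q := by
    by_contra h
    rw [Nat.choose_eq_zero_of_lt (show q + 1 < k + 1 by omega),
      Nat.choose_eq_zero_of_lt (show u + 1 < k by omega)] at hpos
    omega
  have hKne : K.Nonempty := Finset.card_pos.1 (by omega)
  have hKR : K ⊆ R := hR.clique_subset hK (by omega)
  have hKe := edgesIn_of_isClique hK
  rw [hKc, succ_choose_two] at hKe
  have hexc : edgesIn G S + K.card = edgesIn G K + S.card + u := by omega
  have hKconn := connOn_of_isClique hK hKne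
  refine ⟨K, hKR, hK, hKc, hkq, hexc, fun huk => ?_, fun huk => ?_⟩
  · by_contra hne
    obtain ⟨x, hx, hxK⟩ := Finset.exists_of_ssubset (hKR.ssubset_of_ne (Ne.symm hne))
    -- A core vertex outside `K` would need excess k − 1, but only u < k − 1 is available.
    have := hKconn.add_le_of_minDegree (d := k - 1) ⟨x, hx, hxK⟩
      (fun y hy _ => by have := hR.1 y hy; omega) S hS hKS hRS
    omega
  · by_cases hw : ∃ w, w ∉ K ∧ u + 1 ≤ (nbrsIn G w K).card
    · left
      obtain ⟨w, hwK, hwu⟩ := hw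
      have hYR : insert w K ⊆ R := by
        refine hR.2 _ fun v hv => ?_
        rcases Finset.mem_insert.1 hv with rfl | hv
        · rw [nbrsIn_insert_self]
          omega
        · have := card_nbrsIn_mono (G := G) v (Finset.subset_insert w K)
          rw [nbrsIn_of_isClique hK hv, Finset.card_erase_of_mem hv] at this
          omega
      have hYconn : ConnOn G (insert w K) :=
        hKconn.insert_vertex (Finset.card_pos.1 (by omega))
      have hYe := edgesIn_insert (G := G) hwK
      have hYc := Finset.card_insert_of_notMem hwK
      have hYm := hS.edgesIn_mono hYconn (hYR.trans hRS)
      refine ⟨w, hwK, ?_, by omega⟩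
      by_contra hne
      obtain ⟨x, hx, hxK⟩ := Finset.exists_of_ssubset (hYR.ssubset_of_ne (Ne.symm hne))
      -- The vertex `w` already uses the whole excess u, and a further core vertex would need k − 1
      -- ≥ 1 more.
      have := hYconn.add_le_of_minDegree (d := k - 1) ⟨x, hx, hxK⟩
        (fun y hy _ => by have := hR.1 y hy; omega) S hS (hYR.trans hRS) hRS
      omega
    · right
      rcases exists_vertex_of_card_cliquesIn_eq hk hS hK hKne hKS u huk hexc (by
        rw [heq, card_cliquesIn_of_isClique _ hK, hKc]) with ⟨w, -, hwK, hwu⟩ | ⟨h1, h2⟩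
      · exact absurd ⟨w, hwK, hwu⟩ hw
      · refine ⟨h1, h2, fun w hwK => ?_⟩
        by_contra h
        exact hw ⟨w, hwK, by omega⟩

end Structure

/-! ### The exceptional cores: a clique, a path and a triangle -/

section PathToTriangle

variable {V : Type*} [DecidableEq V] {G : SimpleGraph V}

/-- A geodesic between a closest pair of points: meeting `A` or `B` prematurely would give a closer
pair. -/
theorem exists_path_between (hG : G.Connected) {A B : Finset V} (hA : A.Nonempty)
    (hB : B.Nonempty) :
    ∃ (l : ℕ) (p : ℕ → V), p 0 ∈ A ∧ p l ∈ B ∧ (∀ i < l, G.Adj (p i) (p (i + 1))) ∧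
      (∀ i j, i < j → j ≤ l → p i ≠ p j) ∧ (∀ i, 0 < i → i ≤ l → p i ∉ A) ∧
      (∀ i < l, p i ∉ B) ∧ (0 < l → Disjoint A B) := by
  obtain ⟨⟨a, b⟩, hab, hmin⟩ := Finset.exists_min_image (A ×ˢ B) (fun x => G.dist x.1 x.2)
    (hA.product hB)
  rw [Finset.mem_product] at hab
  have hmin' : ∀ x ∈ A, ∀ y ∈ B, G.dist a b ≤ G.dist x y := fun x hx y hy =>
    hmin (x, y) (Finset.mem_product.2 ⟨hx, hy⟩)
  obtain ⟨w, hw, hlen⟩ := hG.exists_path_of_dist a b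
  refine ⟨w.length, w.getVert, by simpa using hab.1, by simpa using hab.2,
    fun i hi => w.adj_getVert_succ hi, fun i j hij hj h => ?_, fun i hi hil h => ?_,
    fun i hi h => ?_, fun hl => ?_⟩
  · have := hw.getVert_injOn (show i ≤ w.length by omega) (show j ≤ w.length from hj) h
    omega
  · have h1 := SimpleGraph.dist_le (w.drop i)
    have h2 := hmin' _ h b hab.2
    rw [SimpleGraph.Walk.drop_length] at h1
    omega
  · have h1 := SimpleGraph.dist_le (w.take i)
    have h2 := hmin' a hab.1 _ h
    rw [SimpleGraph.Walk.take_length] at h1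
    omega
  · rw [Finset.disjoint_left]
    intro x hx hx'
    have := hmin' x hx x hx'
    rw [SimpleGraph.dist_self] at this
    omega

theorem two_le_card_nbrsIn {v a b : V} {Y : Finset V} (ha : a ∈ Y) (hb : b ∈ Y) (hab : a ≠ b)
    (hva : G.Adj v a) (hvb : G.Adj v b) : 2 ≤ (nbrsIn G v Y).card :=
  Finset.one_lt_card.2 ⟨a, mem_nbrsIn.2 ⟨ha, hva⟩, b, mem_nbrsIn.2 ⟨hb, hvb⟩, hab⟩

/-- The available excess is 1, and the closing triangle edge consumes it. Hence there are no further
edges among the listed vertices and no further core vertices. The sequence lists `K`, then the path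
with its end on the triangle, then the other two triangle vertices. -/
theorem IsCore.iso_cliquePathCycle {R S K : Finset V} {r l : ℕ} (hr : 3 ≤ r) (hR : IsCore G 2 R)
    (hRS : R ⊆ S) (hS : ConnOn G S) (hK : G.IsClique (K : Set V)) (hKc : K.card = r)
    (he : edgesIn G S + K.card ≤ edgesIn G K + S.card + 1) (f : ℕ → V)
    (hfK : (Finset.range r).image f = K)
    (hinj : ∀ i j, i < j → j < r + l + 2 → f i ≠ f j)
    (hadj : ∀ i, r ≤ i + 1 → i + 1 < r + l + 2 → G.Adj (f i) (f (i + 1)))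
    (htri : G.Adj (f (r + l - 1)) (f (r + l + 1)))
    (hfS : ∀ i < r + l + 2, f i ∈ S) :
    Nonempty (G.induce (R : Set V) ≃g cliquePathCycle r 3 l) := by
  set Y : ℕ → Finset V := fun j => (Finset.range j).image f with hY
  have hmemY : ∀ i j, i < j → f i ∈ Y j := fun i j h =>
    Finset.mem_image_of_mem f (Finset.mem_range.2 h)
  have hYS : ∀ j ≤ r + l + 2, Y j ⊆ S := by
    intro j hj x hx
    obtain ⟨i, hi, rfl⟩ := Finset.mem_image.1 hx
    exact hfS i (by have := Finset.mem_range.1 hi; omega)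
  have hmono : ∀ i j, i ≤ j → Y i ⊆ Y j := fun i j h =>
    Finset.image_subset_image (Finset.range_subset_range.2 h)
  have hYsucc : ∀ j, Y (j + 1) = insert (f j) (Y j) := fun j => by
    simp only [hY, Finset.range_add_one, Finset.image_insert]
  have hnot : ∀ j, j < r + l + 2 → f j ∉ Y j := by
    intro j hj h
    obtain ⟨i, hi, hij⟩ := Finset.mem_image.1 h
    exact hinj i j (Finset.mem_range.1 hi) hj hij
  have hYcard : ∀ j ≤ r + l + 2, (Y j).card = j := by
    intro j
    induction j with
    | zero => simp [hY]
    | succ j ih =>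
      intro hj
      rw [hYsucc, Finset.card_insert_of_notMem (hnot j (by omega)), ih (by omega)]
  have hYK : Y r = K := hfK
  have hKne : K.Nonempty := Finset.card_pos.1 (by omega)
  have hprev : ∀ j, r ≤ j → j < r + l + 2 → f (j - 1) ∈ nbrsIn G (f j) (Y j) := by
    intro j hj hj'
    have := hadj (j - 1) (by omega) (by omega)
    rw [Nat.sub_add_cancel (by omega)] at this
    exact mem_nbrsIn.2 ⟨hmemY _ _ (by omega), this.symm⟩
  have hconn : ∀ j, r ≤ j → j ≤ r + l + 2 → ConnOn G (Y j) := by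
    intro j hj
    induction j, hj using Nat.le_induction with
    | base =>
      intro _
      rw [hYK]
      exact connOn_of_isClique hK hKne
    | succ j hj ih =>
      intro hj'
      rw [hYsucc]
      exact (ih (by omega)).insert_vertex ⟨_, hprev j hj (by omega)⟩
  have hedge : ∀ j, j < r + l + 2 →
      edgesIn G (Y (j + 1)) = edgesIn G (Y j) + (nbrsIn G (f j) (Y j)).card := fun j hj => by
    rw [hYsucc, edgesIn_insert (hnot j hj)]
  have hstep : ∀ i j, r ≤ i → i ≤ j → j ≤ r + l + 2 →
      edgesIn G (Y i) + j ≤ edgesIn G (Y j) + i := by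
    intro i j hi hij hj
    have := (hconn j (by omega) hj).edgesIn_mono (hconn i hi (by omega)) (hmono i j hij)
    rwa [hYcard i (by omega), hYcard j hj] at this
  have hlast := two_le_card_nbrsIn (G := G) (hmemY (r + l) (r + l + 1) (by omega))
    (hmemY (r + l - 1) (r + l + 1) (by omega)) (hinj _ _ (by omega) (by omega)).symm
    (hadj (r + l) (by omega) (by omega)).symm htri.symm
  have htop := hS.edgesIn_mono (hconn (r + l + 2) (by omega) le_rfl) (hYS _ le_rfl)
  rw [hYcard _ le_rfl] at htop
  have hlaste := hedge (r + l + 1) (by omega)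
  have hKe : edgesIn G (Y r) = edgesIn G K := by rw [hYK]
  -- A second backward neighbour at any vertex before the last would cost one more unit of excess
  -- than there is.
  have hdeg : ∀ j, r ≤ j → j < r + l + 1 → (nbrsIn G (f j) (Y j)).card ≤ 1 := by
    intro j hj hj'
    have h1 := hedge j (by omega)
    have h2 := hstep r j le_rfl hj (by omega)
    have h3 := hstep (j + 1) (r + l + 1) (by omega) (by omega) (by omega)
    have h4 := hlaste
    rw [show r + l + 1 + 1 = r + l + 2 by omega] at h4
    omega
  have hdeglast : (nbrsIn G (f (r + l + 1)) (Y (r + l + 1))).card ≤ 2 := by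
    have h2 := hstep r (r + l + 1) le_rfl (by omega) (by omega)
    have h4 := hlaste
    rw [show r + l + 1 + 1 = r + l + 2 by omega] at h4
    omega
  have hYR : Y (r + l + 2) ⊆ R := by
    refine hR.2 _ fun v hv => ?_
    obtain ⟨i, hi, rfl⟩ := Finset.mem_image.1 hv
    rw [Finset.mem_range] at hi
    rcases Nat.lt_or_ge i r with h | h
    · have hiK : f i ∈ K := hYK ▸ hmemY i r h
      have h1 := card_nbrsIn_mono (G := G) (f i) (hmono r (r + l + 2) (by omega))
      rw [hYK, nbrsIn_of_isClique hK hiK, Finset.card_erase_of_mem hiK] at h1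
      omega
    · rcases Nat.lt_or_ge i (r + l + 1) with h' | h'
      · have h1 := hadj (i - 1) (by omega) (by omega)
        rw [Nat.sub_add_cancel (by omega)] at h1
        exact two_le_card_nbrsIn (hmemY (i - 1) _ (by omega)) (hmemY (i + 1) _ (by omega))
          (hinj _ _ (by omega) (by omega)) h1.symm (hadj i (by omega) (by omega))
      · obtain rfl : i = r + l + 1 := by omega
        exact hlast.trans (card_nbrsIn_mono _ (hmono _ _ (by omega)))
  have hRY : R = Y (r + l + 2) := by
    by_contra hne
    obtain ⟨x, hx, hxY⟩ := Finset.exists_of_ssubset (hYR.ssubset_of_ne (Ne.symm hne))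
    have h1 := (hconn (r + l + 2) (by omega) le_rfl).add_le_of_minDegree (d := 1) ⟨x, hx, hxY⟩
      (fun y hy _ => hR.1 y hy) S hS (hYR.trans hRS) hRS
    have h2 := hstep r (r + l + 1) le_rfl (by omega) (by omega)
    rw [hYcard _ le_rfl] at h1
    have h4 := hlaste
    rw [show r + l + 1 + 1 = r + l + 2 by omega] at h4
    omega
  refine nonempty_induce_iso f ?_ ?_ hinj ?_
  · intro i hi
    exact hYR (hmemY i _ hi)
  · intro x hx
    rw [Finset.mem_coe, hRY] at hx
    obtain ⟨i, hi, hix⟩ := Finset.mem_image.1 hx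
    exact ⟨i, Finset.mem_range.1 hi, hix⟩
  · intro i j hij hj
    have hj : j < r + l + 2 := hj
    simp only [cliquePathCycle, SimpleGraph.fromRel_adj, ne_eq, Fin.mk.injEq]
    constructor
    · intro h
      refine ⟨by omega, Or.inl ?_⟩
      have hin : f i ∈ nbrsIn G (f j) (Y j) := mem_nbrsIn.2 ⟨hmemY i j hij, h.symm⟩
      rcases Nat.lt_or_ge j r with h1 | h1
      · omega
      · have hp := hprev j h1 hj
        rcases Nat.lt_or_ge j (r + l + 1) with h2 | h2
        · have heq := Finset.card_le_one.1 (hdeg j h1 h2) _ hin _ hp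
          have : ¬ i < j - 1 := fun h3 => hinj _ _ h3 (by omega) heq
          omega
        · obtain rfl : j = r + l + 1 := by omega
          by_contra hcon
          have h3 : i < r + l - 1 := by omega
          have hsub : ({f i, f (r + l - 1), f (r + l)} : Finset V) ⊆
              nbrsIn G (f (r + l + 1)) (Y (r + l + 1)) := by
            intro x hx
            simp only [Finset.mem_insert, Finset.mem_singleton] at hx
            rcases hx with rfl | rfl | rfl
            · exact hin
            · exact mem_nbrsIn.2 ⟨hmemY _ _ (by omega), htri.symm⟩
            · exact hp
          have hc := Finset.card_le_card hsub
          rw [Finset.card_eq_three.2 ⟨_, _, _, hinj _ _ h3 (by omega),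
            hinj i (r + l) (by omega) (by omega), hinj _ _ (by omega) (by omega), rfl⟩] at hc
          omega
    · rintro ⟨-, h⟩
      have hcases : j < r ∨ (r ≤ i + 1 ∧ j = i + 1) ∨ (i = r + l - 1 ∧ j = r + l + 1) := by
        omega
      rcases hcases with h | ⟨h1, rfl⟩ | ⟨rfl, rfl⟩
      · exact hK (hYK ▸ hmemY i r (by omega)) (hYK ▸ hmemY j r h) (hinj i j hij (by omega))
      · exact hadj i h1 hj
      · exact htri

theorem IsCore.exists_iso_cliquePathCycle (hG : G.Connected) {R S K Q : Finset V} {r : ℕ}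
    (hr : 3 ≤ r) (hR : IsCore G 2 R) (hRS : R ⊆ S) (hSuniv : ∀ v, v ∈ S) (hS : ConnOn G S)
    (hK : G.IsClique (K : Set V)) (hKc : K.card = r)
    (he : edgesIn G S + K.card ≤ edgesIn G K + S.card + 1)
    (hw : ∀ w, w ∉ K → (nbrsIn G w K).card ≤ 1) (hQ : G.IsClique (Q : Set V)) (hQc : Q.card = 3)
    (hQK : ¬ Q ⊆ K) :
    ∃ l, Nonempty (G.induce (R : Set V) ≃g cliquePathCycle r 3 l) := by
  obtain ⟨l, p, hp0, hpl, hadj, hinj, hpK, hpQ, hdisj⟩ := exists_path_between hG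
    (A := K) (B := Q) (Finset.card_pos.1 (by omega)) (Finset.card_pos.1 (by omega))
  have hQ2 : (Q.erase (p l)).card = 2 := by rw [Finset.card_erase_of_mem hpl, hQc]
  obtain ⟨b, c, hbc, hbcQ⟩ := Finset.card_eq_two.1 hQ2
  have hb : b ∈ Q.erase (p l) := by rw [hbcQ]; simp
  have hc : c ∈ Q.erase (p l) := by rw [hbcQ]; simp
  have hbQ := Finset.mem_of_mem_erase hb
  have hcQ := Finset.mem_of_mem_erase hc
  have hpb := (Finset.ne_of_mem_erase hb).symm
  have hpc := (Finset.ne_of_mem_erase hc).symm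
  -- If the path is trivial and one of the two were in `K`, the other would have two neighbours in
  -- `K`, against `hw`. A nontrivial path means that `K` and `Q` are disjoint.
  have hout : b ∉ K ∧ c ∉ K := by
    rcases Nat.eq_zero_or_pos l with rfl | hl
    · have key : ∀ x y, x ∈ Q → y ∈ Q → p 0 ≠ x → p 0 ≠ y → x ≠ y →
          (∀ z ∈ Q, z = p 0 ∨ z = x ∨ z = y) → x ∉ K := by
        intro x y hx hy hpx hpy hxy hall hxK
        have hyK : y ∉ K := fun hyK => hQK fun z hz => by
          rcases hall z hz with rfl | rfl | rfl
          · exact hp0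
          · exact hxK
          · exact hyK
        have := two_le_card_nbrsIn (G := G) hp0 hxK hpx (hQ hy hpl (Ne.symm hpy))
          (hQ hy hx (Ne.symm hxy))
        have := hw y hyK
        omega
      have hall : ∀ z ∈ Q, z = p 0 ∨ z = b ∨ z = c := by
        intro z hz
        by_cases hzp : z = p 0
        · exact Or.inl hzp
        · have : z ∈ Q.erase (p 0) := Finset.mem_erase.2 ⟨hzp, hz⟩
          rw [hbcQ] at this
          simpa using Or.inr this
      exact ⟨key b c hbQ hcQ hpb hpc hbc hall,
        key c b hcQ hbQ hpc hpb hbc.symm fun z hz => by have := hall z hz; tauto⟩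
    · have := Finset.disjoint_left.1 (hdisj hl)
      exact ⟨fun h => this h hbQ, fun h => this h hcQ⟩
  -- Listing `K` without `p 0` first puts `p 0` at position r − 1, where the path of the model
  -- starts.
  obtain ⟨e, he1, he2, he3, he4, he5⟩ := exists_enumeration (Finset.erase_subset (p 0) K)
    ⟨_, hp0⟩
  rw [hKc] at he1 he3 he4 he5
  rw [Finset.card_erase_of_mem hp0, hKc] at he2 he5
  have hlast : e (r - 1) = p 0 := by
    by_contra h
    exact he5 (r - 1) le_rfl (by omega) (Finset.mem_erase.2 ⟨h, he3 _ (by omega)⟩)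
  let f : ℕ → V := fun i =>
    if i < r then e i else if i < r + l then p (i - (r - 1)) else if i = r + l then b else c
  have f1 : ∀ i < r, f i = e i := fun i hi => if_pos hi
  have f2 : ∀ i ≤ l, f (r - 1 + i) = p i := by
    intro i hi
    rcases Nat.eq_zero_or_pos i with rfl | h
    · rw [← hlast]
      exact f1 _ (by omega)
    · simp only [f]
      rw [if_neg (by omega), if_pos (by omega), Nat.add_sub_cancel_left]
  have f3 : f (r + l) = b := by
    simp only [f]
    rw [if_neg (by omega), if_neg (by omega), if_pos trivial]
  have f4 : f (r + l + 1) = c := by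
    simp only [f]
    rw [if_neg (by omega), if_neg (by omega), if_neg (by omega)]
  have f5 : f (r + l - 1) = p l := by
    rw [← f2 l le_rfl]
    congr 1
    omega
  refine ⟨l, hR.iso_cliquePathCycle hr hRS hS hK hKc he f ?_ ?_ ?_ ?_ fun i _ => hSuniv _⟩
  · ext x
    rw [Finset.mem_image]
    constructor
    · rintro ⟨i, hi, rfl⟩
      rw [Finset.mem_range] at hi
      rw [f1 i hi]
      exact he3 i hi
    · intro hx
      obtain ⟨i, hi, rfl⟩ := he4 x hx
      exact ⟨i, Finset.mem_range.2 hi, f1 i hi⟩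
  · intro i j hij hj
    have hiK : i < r → f i ∈ K := fun h => f1 i h ▸ he3 i h
    have hip : ∀ i, ¬ i < r → i < r + l → f i = p (i - (r - 1)) := fun i h h' => by
      rw [← f2 _ (by omega)]
      congr 1
      omega
    have hjcases : j < r ∨ (r ≤ j ∧ j < r + l) ∨ j = r + l ∨ j = r + l + 1 := by omega
    rcases hjcases with h | ⟨h, h'⟩ | rfl | rfl
    · rw [f1 i (by omega), f1 j h]
      exact he1 i j hij h
    · rw [hip j (by omega) h']
      by_cases hi : i < r
      · intro heq
        exact hpK (j - (r - 1)) (by omega) (by omega) (heq ▸ hiK hi)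
      · rw [hip i hi (by omega)]
        exact hinj _ _ (by omega) (by omega)
    · rw [f3]
      by_cases hi : i < r
      · exact fun heq => hout.1 (heq ▸ hiK hi)
      · rw [hip i hi (by omega)]
        intro heq
        by_cases hil : i - (r - 1) = l
        · exact hpb (hil ▸ heq)
        · exact hpQ (i - (r - 1)) (by omega) (heq ▸ hbQ)
    · rw [f4]
      by_cases hi : i < r
      · exact fun heq => hout.2 (heq ▸ hiK hi)
      · by_cases hi' : i = r + l
        · rw [hi', f3]
          exact hbc
        · rw [hip i hi (by omega)]
          intro heq
          by_cases hil : i - (r - 1) = l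
          · exact hpc (hil ▸ heq)
          · exact hpQ (i - (r - 1)) (by omega) (heq ▸ hcQ)
  · intro i hi hi'
    have hicases : i + 1 < r + l ∨ i = r + l - 1 ∨ i = r + l := by omega
    rcases hicases with h | rfl | rfl
    · have h1 := f2 (i - (r - 1)) (by omega)
      have h2 := f2 (i - (r - 1) + 1) (by omega)
      rw [show r - 1 + (i - (r - 1)) = i by omega] at h1
      rw [show r - 1 + (i - (r - 1) + 1) = i + 1 by omega] at h2
      rw [h1, h2]
      exact hadj _ (by omega)
    · rw [f5, Nat.sub_add_cancel (by omega), f3]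
      exact hQ hpl hbQ hpb
    · rw [f3, f4]
      exact hQ hbQ hcQ hbc
  · rw [f5, f4]
    exact hQ hpl hcQ hpc

end PathToTriangle

/-! ### From `SimpleGraph` notions to finite sets, isomorphisms, and sharpness -/

section Translation

variable {V : Type*} [DecidableEq V] {G : SimpleGraph V}

theorem connOn_univ [Fintype V] (hG : G.Connected) : ConnOn G Finset.univ := by
  refine ⟨Finset.univ_nonempty_iff.2 hG.nonempty, fun A _ hne hA => ?_⟩
  obtain ⟨a, ha⟩ := hne
  obtain ⟨b, hb⟩ : ∃ b, b ∉ A := by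
    by_contra h
    push Not at h
    exact hA (Finset.eq_univ_iff_forall.2 h)
  obtain ⟨w⟩ := hG.preconnected a b
  obtain ⟨d, -, hd1, hd2⟩ := w.exists_boundary_dart (A : Set V) ha hb
  exact ⟨d.fst, hd1, d.snd, Finset.mem_univ _, hd2, d.adj⟩

theorem cliqueCount_eq [Fintype V] (s : ℕ) :
    cliqueCount s G = (cliquesIn G s Finset.univ).card := by
  rw [cliqueCount, ← Set.ncard_coe_finset]
  congr 1
  ext T
  simp [SimpleGraph.isNClique_iff, and_comm]

theorem ncard_edgeSet_eq [Fintype V] : G.edgeSet.ncard = edgesIn G Finset.univ := by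
  classical
  have h1 := G.sum_degrees_eq_twice_card_edges
  have h2 := sum_card_nbrsIn (G := G) Finset.univ
  have h3 : ∀ v, G.degree v = (nbrsIn G v Finset.univ).card := fun v => by
    rw [← SimpleGraph.card_neighborFinset_eq_degree]
    congr 1
    ext w
    simp
  simp only [h3] at h1
  rw [Set.ncard_eq_toFinset_card', ← SimpleGraph.edgeFinset]
  omega

theorem degIn_coe (S : Finset V) (v : V) : degIn G S v = (nbrsIn G v S).card := by
  rw [degIn, ← Set.ncard_coe_finset]
  congr 1
  ext w
  simp [and_comm]

/-- A set of minimum degree above k never loses a vertex: its first deleted vertex would still have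
all its neighbours in the set. -/
theorem subset_of_deletesTo [Finite V] {k : ℕ} {T S : Set V} (hT : ∀ v ∈ T, k + 1 ≤ degIn G T v)
    (hS : DeletesTo G k S) : T ⊆ S := by
  induction hS with
  | start => exact Set.subset_univ T
  | @delete S v _ _ hdeg ih =>
    intro x hx
    refine ⟨ih hx, ?_⟩
    rintro rfl
    have h1 := hT x hx
    have h2 : degIn G T x ≤ degIn G S x :=
      Set.ncard_le_ncard (Set.inter_subset_inter_right _ ih) (Set.toFinite _)
    omega

theorem isCore_of_coe_eq_residue [Finite V] {k : ℕ} {R : Finset V}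
    (hR : (R : Set V) = residue G k) : IsCore G (k + 1) R := by
  have h := isResidue_residue G k
  rw [← hR] at h
  refine ⟨fun v hv => ?_, fun T hT => ?_⟩
  · rw [← degIn_coe]
    exact h.2 v hv
  · rw [← Finset.coe_subset]
    refine subset_of_deletesTo (fun v hv => ?_) h.1
    rw [degIn_coe]
    exact hT v hv

theorem card_cliquesIn_insert_of_isClique (k : ℕ) {K : Finset V} {w : V} (hw : w ∉ K)
    (hK : G.IsClique (K : Set V)) :
    (cliquesIn G (k + 1) (insert w K)).card =
      K.card.choose (k + 1) + (nbrsIn G w K).card.choose k := by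
  rw [card_cliquesIn_insert k hw, card_cliquesIn_of_isClique _ hK,
    card_cliquesIn_of_isClique k (hK.subset (Finset.coe_subset.2 (nbrsIn_subset w K)))]

theorem nonempty_induce_iso_top {K : Finset V} (hK : G.IsClique (K : Set V)) :
    Nonempty (G.induce (K : Set V) ≃g (⊤ : SimpleGraph (Fin K.card))) := by
  rcases K.eq_empty_or_nonempty with rfl | hne
  · refine ⟨⟨⟨fun x => absurd x.2 (by simp), fun i => i.elim0, fun x => absurd x.2 (by simp),
      fun i => i.elim0⟩, fun {x} => absurd x.2 (by simp)⟩⟩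
  obtain ⟨f, h1, -, h2, h3, -⟩ := exists_enumeration (Finset.empty_subset K) hne
  refine nonempty_induce_iso f h2 (fun x hx => h3 x hx) h1 fun i j hij hj => ?_
  rw [SimpleGraph.top_adj]
  refine iff_of_true (hK (h2 i (hij.trans hj)) (h2 j hj) (h1 i j hij hj)) fun h => ?_
  exact hij.ne (congrArg Fin.val h)

theorem nonempty_induce_iso_cliquePlus {K : Finset V} {w : V} (hw : w ∉ K)
    (hK : G.IsClique (K : Set V)) (hne : K.Nonempty) :
    Nonempty (G.induce (insert w K : Finset V) ≃g
      cliquePlus K.card (nbrsIn G w K).card) := by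
  obtain ⟨f, h1, h2, h3, h4, h5⟩ := exists_enumeration (nbrsIn_subset (G := G) w K) hne
  have g1 : ∀ i < K.card, Function.update f K.card w i = f i := fun i hi =>
    Function.update_of_ne hi.ne _ _
  have g2 : Function.update f K.card w K.card = w := Function.update_self _ _ _
  refine nonempty_induce_iso (Function.update f K.card w) ?_ ?_ ?_ ?_
  · intro i hi
    rw [Finset.mem_coe, Finset.mem_insert]
    rcases (Nat.lt_succ_iff.1 hi).lt_or_eq with h | rfl
    · rw [g1 i h]
      exact Or.inr (h3 i h)
    · exact Or.inl g2
  · intro x hx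
    rw [Finset.mem_coe, Finset.mem_insert] at hx
    rcases hx with rfl | hx
    · exact ⟨_, Nat.lt_succ_self _, g2⟩
    · obtain ⟨i, hi, rfl⟩ := h4 x hx
      exact ⟨i, hi.trans (Nat.lt_succ_self _), g1 i hi⟩
  · intro i j hij hj
    rcases (Nat.lt_succ_iff.1 hj).lt_or_eq with h | rfl
    · rw [g1 i (hij.trans h), g1 j h]
      exact h1 i j hij h
    · rw [g1 i hij, g2]
      exact fun h => hw (h ▸ h3 i hij)
  · intro i j hij hj
    simp only [cliquePlus, SimpleGraph.fromRel_adj, ne_eq, Fin.mk.injEq]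
    have hd : (nbrsIn G w K).card ≤ K.card := Finset.card_le_card (nbrsIn_subset w K)
    rcases (Nat.lt_succ_iff.1 hj).lt_or_eq with h | rfl
    · rw [g1 i (hij.trans h), g1 j h]
      exact iff_of_true (hK (h3 i (hij.trans h)) (h3 j h) (h1 i j hij h)) (by omega)
    · rw [g1 i hij, g2]
      constructor
      · intro h
        refine ⟨by omega, Or.inl (Or.inr ⟨?_, rfl⟩)⟩
        by_contra h'
        exact h5 i (by omega) hij (mem_nbrsIn.2 ⟨h3 i hij, h.symm⟩)
      · rintro ⟨-, h⟩
        exact (mem_nbrsIn.1 (h2 i (by omega))).2.symm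

/-- A copy in `G` of a graph on `Fin N`, as a sequence of vertices. -/
theorem exists_sequence_of_iso {R : Set V} {N : ℕ} {H : SimpleGraph (Fin N)} (hN : 0 < N)
    (h : Nonempty (G.induce R ≃g H)) :
    ∃ f : ℕ → V, (∀ i j, i < j → j < N → f i ≠ f j) ∧
      ∀ i j (hi : i < N) (hj : j < N), H.Adj ⟨i, hi⟩ ⟨j, hj⟩ → G.Adj (f i) (f j) := by
  obtain ⟨φ⟩ := h
  have hf : ∀ i (hi : i < N), (fun i => if hi : i < N then (φ.symm ⟨i, hi⟩ : V)
      else φ.symm ⟨0, hN⟩) i = φ.symm ⟨i, hi⟩ := fun i hi => dif_pos hi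
  refine ⟨fun i => if hi : i < N then (φ.symm ⟨i, hi⟩ : V) else φ.symm ⟨0, hN⟩, ?_, ?_⟩
  · intro i j hij hj
    rw [hf i (hij.trans hj), hf j hj]
    intro heq
    have := φ.symm.injective (Subtype.ext heq)
    simp only [Fin.mk.injEq] at this
    omega
  · intro i j hi hj hadj
    rw [hf i hi, hf j hj]
    exact φ.symm.map_rel_iff.2 hadj

theorem isClique_image_range {f : ℕ → V} {r : ℕ}
    (hadj : ∀ i j, i < j → j < r → G.Adj (f i) (f j)) :
    G.IsClique ((Finset.range r).image f : Finset V) := by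
  intro x hx y hy hxy
  obtain ⟨i, hi, rfl⟩ := Finset.mem_image.1 hx
  obtain ⟨j, hj, rfl⟩ := Finset.mem_image.1 hy
  rw [Finset.mem_range] at hi hj
  rcases lt_trichotomy i j with h | rfl | h
  · exact hadj i j h hj
  · exact absurd rfl hxy
  · exact (hadj j i h hi).symm

theorem card_image_range {f : ℕ → V} {r N : ℕ} (hinj : ∀ i j, i < j → j < N → f i ≠ f j)
    (hr : r ≤ N) : ((Finset.range r).image f).card = r := by
  rw [Finset.card_image_of_injOn, Finset.card_range]
  intro i hi j hj h
  simp only [Finset.coe_range, Set.mem_Iio] at hi hj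
  rcases lt_trichotomy i j with h' | h' | h'
  · exact absurd h (hinj _ _ h' (by omega))
  · exact h'
  · exact absurd h.symm (hinj _ _ h' (by omega))

theorem choose_add_choose_le_card_cliquesIn (k : ℕ) {S : Finset V} {f : ℕ → V} {r t : ℕ}
    (htr : t ≤ r) (hf : ∀ i ≤ r, f i ∈ S) (hinj : ∀ i j, i < j → j < r + 1 → f i ≠ f j)
    (hadj : ∀ i j, i < j → j < r → G.Adj (f i) (f j)) (hadj' : ∀ i < t, G.Adj (f i) (f r)) :
    r.choose (k + 1) + t.choose k ≤ (cliquesIn G (k + 1) S).card := by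
  have hK := isClique_image_range hadj
  have hc := card_image_range hinj (show r ≤ r + 1 by omega)
  have hr : f r ∉ (Finset.range r).image f := by
    intro h
    obtain ⟨i, hi, h⟩ := Finset.mem_image.1 h
    exact hinj i r (Finset.mem_range.1 hi) (by omega) h
  have h1 := card_cliquesIn_insert_of_isClique k hr hK
  have h2 : (Finset.range t).image f ⊆ nbrsIn G (f r) ((Finset.range r).image f) := by
    intro x hx
    obtain ⟨i, hi, rfl⟩ := Finset.mem_image.1 hx
    rw [Finset.mem_range] at hi
    exact mem_nbrsIn.2 ⟨Finset.mem_image_of_mem f (Finset.mem_range.2 (by omega)),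
      (hadj' i hi).symm⟩
  have h3 := Finset.card_le_card h2
  rw [card_image_range hinj (show t ≤ r + 1 by omega)] at h3
  have h4 := Nat.choose_le_choose k h3
  have h5 : insert (f r) ((Finset.range r).image f) ⊆ S := by
    refine Finset.insert_subset (hf r le_rfl) fun x hx => ?_
    obtain ⟨i, hi, rfl⟩ := Finset.mem_image.1 hx
    exact hf i (Finset.mem_range.1 hi).le
  have h6 := card_cliquesIn_mono (G := G) (k + 1) h5
  rw [hc] at h1
  omega

theorem card_cliquesIn_of_iso_top [Fintype V] {R : Set V} {r : ℕ} (hr : 0 < r) (k : ℕ)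
    (h : Nonempty (G.induce R ≃g (⊤ : SimpleGraph (Fin r)))) :
    r.choose k ≤ (cliquesIn G k Finset.univ).card := by
  obtain ⟨f, hinj, hadj⟩ := exists_sequence_of_iso hr h
  have hK : G.IsClique ((Finset.range r).image f : Finset V) :=
    isClique_image_range fun i j hij hj => hadj i j (hij.trans hj) hj (by
      rw [SimpleGraph.top_adj, ne_eq, Fin.mk.injEq]
      omega)
  have hc := card_cliquesIn_of_isClique k hK
  rw [card_image_range hinj le_rfl] at hc
  rw [← hc]
  exact card_cliquesIn_mono k (Finset.subset_univ _)

theorem card_cliquesIn_of_iso_cliquePlus [Fintype V] {R : Set V} {r t : ℕ} (htr : t ≤ r) (k : ℕ)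
    (h : Nonempty (G.induce R ≃g cliquePlus r t)) :
    r.choose (k + 1) + t.choose k ≤ (cliquesIn G (k + 1) Finset.univ).card := by
  obtain ⟨f, hinj, hadj⟩ := exists_sequence_of_iso (by omega) h
  simp only [cliquePlus, SimpleGraph.fromRel_adj, ne_eq, Fin.mk.injEq] at hadj
  exact choose_add_choose_le_card_cliquesIn k htr (fun _ _ => Finset.mem_univ _) hinj
    (fun i j hij hj => hadj i j (by omega) (by omega) (by omega))
    (fun i hi => hadj i r (by omega) (by omega) (by omega))

theorem card_cliquesIn_of_iso_cliquePathCycle [Fintype V] {R : Set V} {r l : ℕ} (hr : 0 < r)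
    (h : Nonempty (G.induce R ≃g cliquePathCycle r 3 l)) :
    r.choose 3 + 1 ≤ (cliquesIn G 3 Finset.univ).card := by
  obtain ⟨f, hinj, hadj⟩ := exists_sequence_of_iso (by omega) h
  simp only [cliquePathCycle, SimpleGraph.fromRel_adj, ne_eq, Fin.mk.injEq] at hadj
  have hK : G.IsClique ((Finset.range r).image f : Finset V) :=
    isClique_image_range fun i j hij hj => hadj i j (by omega) (by omega) (by omega)
  have hc := card_image_range hinj (show r ≤ r + l + 3 - 1 by omega)
  have h1 := card_cliquesIn_of_isClique 3 hK
  rw [hc] at h1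
  have h01 := hadj (r + l - 1) (r + l) (by omega) (by omega) (by omega)
  have h02 := hadj (r + l - 1) (r + l + 1) (by omega) (by omega) (by omega)
  have h12 := hadj (r + l) (r + l + 1) (by omega) (by omega) (by omega)
  have hQ : {f (r + l - 1), f (r + l), f (r + l + 1)} ∈ cliquesIn G 3 Finset.univ := by
    have := SimpleGraph.is3Clique_triple_iff.2 ⟨h01, h02, h12⟩
    exact mem_cliquesIn.2 ⟨⟨Finset.subset_univ _, this.2⟩, this.1⟩
  have hQK : {f (r + l - 1), f (r + l), f (r + l + 1)} ∉
      cliquesIn G 3 ((Finset.range r).image f) := by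
    intro h
    have h' := (mem_cliquesIn.1 h).1.1 (show f (r + l + 1) ∈ _ by simp)
    obtain ⟨i, hi, h'⟩ := Finset.mem_image.1 h'
    rw [Finset.mem_range] at hi
    exact hinj i (r + l + 1) (by omega) (by omega) h'
  rw [← h1]
  exact Finset.card_lt_card ((Finset.ssubset_iff_of_subset
    (cliquesIn_mono 3 (Finset.subset_univ _))).2 ⟨_, hQ, hQK⟩)

/-- A connected graph attaining the bound: `K_r^t` with pendant vertices. -/
theorem exists_connGraph_cliqueCount_ge {n r t : ℕ} (k : ℕ) (ht : 1 ≤ t) (htr : t ≤ r)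
    (hrn : r < n) :
    ∃ H : SimpleGraph (Fin n), IsConnGraph (r.choose 2 + t + (n - r - 1)) n H ∧
      r.choose (k + 1) + t.choose k ≤ cliqueCount (k + 1) H := by
  let H : SimpleGraph (Fin n) := SimpleGraph.fromRel fun i j =>
    (i.val < r ∧ j.val < r) ∨ (i.val < t ∧ j.val = r) ∨ (i.val = 0 ∧ r < j.val)
  -- Vertices beyond r are pendant at vertex 0, so they keep the graph connected without changing
  -- its cyclomatic number.
  have hadj : ∀ i j : Fin n, i < j → (H.Adj i j ↔
      ((i.val < r ∧ j.val < r) ∨ (i.val < t ∧ j.val = r) ∨ (i.val = 0 ∧ r < j.val))) := by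
    intro i j hij
    simp only [H, SimpleGraph.fromRel_adj, ne_eq]
    have : i.val < j.val := hij
    refine ⟨fun h => by omega, fun h => ⟨fun h' => by omega, Or.inl h⟩⟩
  have hzero : ∀ j : Fin n, (⟨0, by omega⟩ : Fin n) < j → H.Adj ⟨0, by omega⟩ j := by
    intro j hj
    rw [hadj _ _ hj]
    simp only [true_and]
    omega
  let Y : ℕ → Finset (Fin n) := fun j => Finset.univ.filter fun i => i.val < j
  have hmem : ∀ i j, i ∈ Y j ↔ i.val < j := fun i j => by simp [Y]
  have hY : ∀ j (hj : j < n), Y (j + 1) = insert ⟨j, hj⟩ (Y j) := by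
    intro j hj
    ext i
    rw [Finset.mem_insert, hmem, hmem, Fin.ext_iff]
    exact Nat.lt_succ_iff_lt_or_eq.trans or_comm
  have hYn : Y n = Finset.univ := Finset.eq_univ_iff_forall.2 fun i => (hmem i n).2 i.2
  have hnot : ∀ j (hj : j < n), (⟨j, hj⟩ : Fin n) ∉ Y j := fun j hj h => by
    have := (hmem _ _).1 h
    simp at this
  have hcard : ∀ j ≤ n, (Y j).card = j := by
    intro j
    induction j with
    | zero => simp [Y]
    | succ j ih =>
      intro hj
      rw [hY j hj, Finset.card_insert_of_notMem (hnot j hj), ih (by omega)]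
  have hclique : H.IsClique (Y r : Set (Fin n)) := by
    intro a ha b hb hab
    rw [Finset.mem_coe, hmem] at ha hb
    rcases lt_or_gt_of_ne hab with h | h
    · exact (hadj a b h).2 (Or.inl ⟨ha, hb⟩)
    · exact ((hadj b a h).2 (Or.inl ⟨hb, ha⟩)).symm
  have hnbr : nbrsIn H ⟨r, hrn⟩ (Y r) = Y t := by
    ext i
    rw [mem_nbrsIn, hmem, hmem]
    constructor
    · rintro ⟨h1, h2⟩
      have := (hadj i ⟨r, hrn⟩ h1).1 h2.symm
      simp only at this
      omega
    · intro h
      exact ⟨by omega, ((hadj i ⟨r, hrn⟩ (show i.val < r by omega)).2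
        (Or.inr (Or.inl ⟨h, rfl⟩))).symm⟩
  have hnbr' : ∀ j (hj : j < n), r < j → nbrsIn H ⟨j, hj⟩ (Y j) = {⟨0, by omega⟩} := by
    intro j hj hrj
    ext i
    rw [mem_nbrsIn, hmem, Finset.mem_singleton, Fin.ext_iff]
    constructor
    · rintro ⟨h1, h2⟩
      have := (hadj i ⟨j, hj⟩ h1).1 h2.symm
      simp only at this
      simp only
      omega
    · intro h
      simp only at h
      exact ⟨by omega, ((hadj i ⟨j, hj⟩ (show i.val < j by omega)).2
        (Or.inr (Or.inr ⟨h, hrj⟩))).symm⟩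
  have hedge : ∀ j, r + 1 ≤ j → j ≤ n → edgesIn H (Y j) = r.choose 2 + t + (j - r - 1) := by
    intro j hj
    induction j, hj using Nat.le_induction with
    | base =>
      intro _
      rw [hY r hrn, edgesIn_insert (hnot r hrn), edgesIn_of_isClique hclique, hcard r hrn.le, hnbr,
        hcard t (by omega)]
      omega
    | succ j hj ih =>
      intro hjn
      rw [hY j hjn, edgesIn_insert (hnot j hjn), hnbr' j hjn hj, ih (by omega),
        Finset.card_singleton]
      omega
  have hconn : H.Connected := by
    have hreach : ∀ j, H.Reachable ⟨0, by omega⟩ j := by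
      intro j
      by_cases h : (⟨0, by omega⟩ : Fin n) = j
      · rw [h]
      · refine (hzero j (Fin.lt_def.2 (Nat.pos_of_ne_zero fun h' => h (Fin.ext ?_)))).reachable
        exact h'.symm
    have : Nonempty (Fin n) := ⟨⟨0, by omega⟩⟩
    exact ⟨fun i j => (hreach i).symm.trans (hreach j)⟩
  refine ⟨H, ⟨hconn, by simp, ?_⟩, ?_⟩
  · rw [ncard_edgeSet_eq, ← hYn, hedge n hrn le_rfl]
  · have h1 := card_cliquesIn_insert_of_isClique k (hnot r hrn) hclique
    rw [hnbr, hcard t (by omega), hcard r hrn.le] at h1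
    rw [cliqueCount_eq, ← h1]
    exact card_cliquesIn_mono _ (Finset.subset_univ _)

theorem IsConnGraph.cliqueCount_le [Finite V] {m n k b : ℕ} (hk : 2 ≤ k)
    (hG : IsConnGraph m n G) (hb : m + 1 = n + b) : cliqueCount (k + 1) G ≤ maxCliques k b := by
  have := Fintype.ofFinite V
  obtain ⟨h1, h2, h3⟩ := hG
  rw [ncard_edgeSet_eq] at h3
  rw [Nat.card_eq_fintype_card, ← Finset.card_univ] at h2
  rw [cliqueCount_eq]
  exact (card_cliquesIn_le_maxCliques hk _ (connOn_univ h1) b (by omega)).1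

theorem IsConnGraph.isExtremal_iff [Finite V] {m n k r t : ℕ} (hk : 2 ≤ k)
    (hG : IsConnGraph m n G) (ht : 1 ≤ t) (htr : t ≤ r) (hrn : r < n)
    (hm : m + 1 = n + ((r - 1).choose 2 + (t - 1))) :
    IsExtremal m n (k + 1) G ↔
      cliqueCount (k + 1) G = maxCliques k ((r - 1).choose 2 + (t - 1)) := by
  constructor
  · rintro ⟨-, h⟩
    refine le_antisymm (hG.cliqueCount_le hk hm) ?_
    obtain ⟨H, hH, hH'⟩ := exists_connGraph_cliqueCount_ge (n := n) k ht htr hrn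
    have hr := succ_choose_two (r - 1)
    rw [Nat.sub_add_cancel (by omega)] at hr
    rw [show r.choose 2 + t + (n - r - 1) = m by omega] at hH
    rw [maxCliques_of_le hk (by omega), Nat.sub_add_cancel ht, Nat.sub_add_cancel (by omega)]
    exact hH'.trans (h H hH)
  · intro h
    exact ⟨hG, fun H hH => h ▸ hH.cliqueCount_le hk hm⟩

/-- The possible cores of a connected graph with the most cliques. -/
theorem residueGraph_of_cliqueCount_eq [Fintype V] {m n k r t : ℕ} (hk : 2 ≤ k)
    (hG : IsConnGraph m n G) (ht : 2 ≤ t) (htr : t ≤ r)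
    (hm : m + 1 = n + ((r - 1).choose 2 + (t - 1)))
    (hcount : cliqueCount (k + 1) G = maxCliques k ((r - 1).choose 2 + (t - 1)))
    (hpos : 0 < maxCliques k ((r - 1).choose 2 + (t - 1))) :
    (t < k → t < r → Nonempty (residueGraph G (k - 1) ≃g (⊤ : SimpleGraph (Fin r)))) ∧
      (k ≤ t → (Nonempty (residueGraph G (k - 1) ≃g cliquePlus r t) ∨
        (k = 2 ∧ t = 2 ∧ 3 ≤ r ∧ IsCliquePathCycle r 3 (residueGraph G (k - 1))))) := by
  obtain ⟨hconn, hcard, hedges⟩ := hG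
  rw [ncard_edgeSet_eq] at hedges
  rw [Nat.card_eq_fintype_card, ← Finset.card_univ] at hcard
  rw [cliqueCount_eq] at hcount
  obtain ⟨R, hRset⟩ := (Set.toFinite (residue G (k - 1))).exists_finset_coe
  have hR := isCore_of_coe_eq_residue hRset
  rw [Nat.sub_add_cancel (by omega)] at hR
  have hS := connOn_univ hconn
  rw [residueGraph, ← hRset]
  rcases htr.lt_or_eq with h | rfl
  · obtain ⟨K, hKR, hK, hKc, hkq, hexc, h1, h2⟩ := hR.structure_of_card_eq hk
      (Finset.subset_univ _) hS (show t - 1 < r - 1 by omega) (by omega) hcount hpos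
    rw [Nat.sub_add_cancel (by omega)] at hKc h1 h2
    subst hKc
    refine ⟨fun htk _ => ?_, fun hkt => ?_⟩
    · rw [h1 htk]
      exact nonempty_induce_iso_top hK
    · rcases h2 hkt with ⟨w, hwK, rfl, hwc⟩ | ⟨rfl, ht1, hw⟩
      · left
        obtain rfl : t = (nbrsIn G w K).card := by omega
        exact nonempty_induce_iso_cliquePlus hwK hK (Finset.card_pos.1 (by omega))
      · right
        obtain rfl : t = 2 := by omega
        refine ⟨rfl, rfl, h, ?_⟩
        -- Here the bound is C(r,3) + 1, one more than the triangles of `K`, so some triangle leaves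
        -- `K`.
        have hlt : (cliquesIn G 3 K).card < (cliquesIn G 3 Finset.univ).card := by
          rw [hcount, maxCliques_of_le le_rfl (by omega), card_cliquesIn_of_isClique 3 hK,
            Nat.sub_add_cancel (by omega)]
          simp
        obtain ⟨Q, hQ, hQK⟩ := Finset.exists_mem_notMem_of_card_lt_card hlt
        rw [mem_cliquesIn] at hQ
        exact hR.exists_iso_cliquePathCycle hconn h (Finset.subset_univ _) Finset.mem_univ hS hK
          rfl (by omega) hw hQ.2 hQ.1.2 fun h' => hQK (mem_cliquesIn.2 ⟨⟨h', hQ.1.2⟩, hQ.2⟩)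
  · refine ⟨fun _ h => absurd h (lt_irrefl t), fun hkt => Or.inl ?_⟩
    -- For t = r the decomposition has q = r and u = 0: the core is a clique on r + 1 vertices,
    -- which is K_r^r with any of its vertices as the new one.
    have hb : (t - 1).choose 2 + (t - 1) = t.choose 2 + 0 := by
      have := succ_choose_two (t - 1)
      rw [Nat.sub_add_cancel (by omega)] at this
      omega
    rw [hb] at hm hcount hpos
    obtain ⟨K, hKR, hK, hKc, hkq, hexc, h1, h2⟩ := hR.structure_of_card_eq hk
      (Finset.subset_univ _) hS (show 0 < t by omega) (by omega) hcount hpos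
    rw [h1 (by omega)]
    obtain ⟨w, hw⟩ : K.Nonempty := Finset.card_pos.1 (by omega)
    have hKw : G.IsClique (K.erase w : Set V) :=
      hK.subset (Finset.coe_subset.2 (Finset.erase_subset w K))
    have hc : (K.erase w).card = t := by rw [Finset.card_erase_of_mem hw, hKc]; rfl
    have h3 := nonempty_induce_iso_cliquePlus (Finset.notMem_erase w K) hKw
      (Finset.card_pos.1 (by omega))
    rwa [← nbrsIn_insert_self, Finset.insert_erase hw, nbrsIn_of_isClique hK hw, hc] at h3

end Translation

end CliqueExtremal

/-! ### The theorem -/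

theorem theorem222 {V : Type*} [Finite V] (m n s r t : ℕ) (hs : 3 ≤ s)
    (hlow : (s.choose 2 : ℤ) - s ≤ (m : ℤ) - n)
    (hupp : (m : ℤ) - n ≤ (n.choose 2 : ℤ) - n)
    (hrt : CliqueExtremal.IsParams m n r t)
    (G : SimpleGraph V) (hG : CliqueExtremal.IsConnGraph m n G) :
    (t ≤ s - 2 →
      (CliqueExtremal.IsExtremal m n s G ↔
        Nonempty (CliqueExtremal.residueGraph G (s - 2) ≃g (⊤ : SimpleGraph (Fin r))))) ∧
    (s - 1 ≤ t →
      (CliqueExtremal.IsExtremal m n s G ↔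
        (Nonempty (CliqueExtremal.residueGraph G (s - 2) ≃g CliqueExtremal.cliquePlus r t) ∨
          (s = 3 ∧ t = 2 ∧ 3 ≤ r ∧
            CliqueExtremal.IsCliquePathCycle r 3 (CliqueExtremal.residueGraph G (s - 2)))))) := by
  classical
  have := Fintype.ofFinite V
  obtain ⟨k, rfl⟩ := Nat.exists_eq_add_of_le' (show 1 ≤ s by omega)
  obtain ⟨hr1, -, hmn, hle, -⟩ := hrt
  have hk : 2 ≤ k := by omega
  have hsk := CliqueExtremal.succ_choose_two k
  have hk1 := CliqueExtremal.succ_choose_two (k - 1)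
  rw [Nat.sub_add_cancel (by omega)] at hk1
  obtain ⟨ht, htr⟩ := hle (by omega)
  have hm : m + 1 = n + ((r - 1).choose 2 + (t - 1)) := by omega
  -- The upper bound on m − n leaves room for the extra vertex of K_r^t; otherwise m − n ≥ C(n−1,2)
  -- > C(n,2) − n.
  have hrn : r < n := by
    by_contra h
    have hn : 1 ≤ n := by
      rw [← hG.2.1]
      have := hG.1.nonempty
      exact Nat.card_pos
    have h1 := CliqueExtremal.succ_choose_two (n - 1)
    rw [Nat.sub_add_cancel hn] at h1
    have h2 := Nat.choose_le_choose 2 (show n - 1 ≤ r - 1 by omega)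
    omega
  have hkr : k ≤ r := by
    by_contra h
    have h1 := CliqueExtremal.succ_choose_two (r - 1)
    rw [Nat.sub_add_cancel hr1] at h1
    have h2 := Nat.choose_le_choose 2 (show r ≤ k - 1 by omega)
    omega
  -- The lower bound gives m − n ≥ C(k−1,2) + k − 2, so r = k would force t ≥ k. Hence K_r contains
  -- a (k+1)-clique, and the maximum is positive even when the extra vertex contributes nothing.
  have hstrict : t < k → t < r ∧ k < r := by
    intro htk
    refine ⟨by omega, lt_of_le_of_ne hkr ?_⟩
    rintro rfl
    omega
  have hval := CliqueExtremal.maxCliques_of_le (q := r - 1) (u := t - 1) hk (by omega)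
  rw [Nat.sub_add_cancel (by omega), Nat.sub_add_cancel (by omega)] at hval
  have hpos : 0 < CliqueExtremal.maxCliques k ((r - 1).choose 2 + (t - 1)) := by
    rw [hval]
    rcases Nat.lt_or_ge t k with h | h
    · exact Nat.add_pos_left (Nat.choose_pos (hstrict h).2) _
    · exact Nat.add_pos_right _ (Nat.choose_pos h)
  have hext := hG.isExtremal_iff hk (by omega) htr hrn hm
  have hupper := hG.cliqueCount_le hk hm
  rw [hext, show k + 1 - 2 = k - 1 by omega, show k + 1 - 1 = k by omega]
  refine ⟨fun h => ⟨fun hc => ?_, fun hiso => ?_⟩, fun h => ⟨fun hc => ?_, fun hiso => ?_⟩⟩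
  · exact (CliqueExtremal.residueGraph_of_cliqueCount_eq hk hG ht htr hm hc hpos).1 (by omega)
      (hstrict (by omega)).1
  · have h1 := CliqueExtremal.card_cliquesIn_of_iso_top hr1 (k + 1) hiso
    rw [← CliqueExtremal.cliqueCount_eq] at h1
    rw [Nat.choose_eq_zero_of_lt (show t < k by omega)] at hval
    omega
  · rcases (CliqueExtremal.residueGraph_of_cliqueCount_eq hk hG ht htr hm hc hpos).2 h with
      h' | ⟨h1, h2⟩
    · exact Or.inl h'
    · exact Or.inr ⟨by omega, h2⟩
  · refine le_antisymm hupper ?_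
    rw [hval]
    rcases hiso with hiso | ⟨h1, rfl, h3, l, hiso⟩
    · rw [CliqueExtremal.cliqueCount_eq]
      exact CliqueExtremal.card_cliquesIn_of_iso_cliquePlus htr k hiso
    · obtain rfl : k = 2 := by omega
      rw [CliqueExtremal.cliqueCount_eq]
      simpa using CliqueExtremal.card_cliquesIn_of_iso_cliquePathCycle hr1 hiso
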